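/- **Setting.** Let $\mathcal C$, $\mathcal P$, $\mathcal F$ be $C^\infty$ Banach manifolds (real, without boundary, each modelled on a Banach space). A subset $S$ of a Banach manifold $X$ is a $C^\infty$ *submanifold* if near each of its points there is a smooth chart of $X$ in which $S$ becomes a closed linear subspace with a closed complement; its codimension at $x\in S$ is $\operatorname{codim}_x(S;X)=\dim(T_xX/T_xS)\in\mathbb N\cup\{\infty\}$. Submanifolds of a submanifold, and their codimension, are understood in the same way. Let $\mathcal M\subset\mathcal C\times\mathcal P$ be a $C^\infty$ Banach submanifold whose topology has a countable base, and suppose that the restriction $\pi:\mathcal M\to\mathcal P$ of the projection $\mathcal C\times\mathcal P\to\mathcal P$ is a Fredholm map, i.e. every differential $(D\pi)_{(c,p)}:T_{(c,p)}\mathcal M\to T_p\mathcal P$ is a Fredholm operator. Let $\underline P:\mathcal M\to\mathcal F$ be a $C^\infty$ map that is transverse to a $C^\infty$ Banach submanifold $\mathcal J\subset\mathcal F$. (A smooth map $f:S\to\mathcal F$ is *transverse* to $\mathcal J$ if for every $x\in S$ with $f(x)\in\mathcal J$ the composition $T_xS\to T_{f(x)}\mathcal F\to T_{f(x)}\mathcal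 F/T_{f(x)}\mathcal J$ is surjective and its kernel has a closed complement in $T_xS$.) **Proposition 4.7.** There is a first-category subset $\mathcal P_{\mathrm{fc}}\subset\mathcal P$ (one contained in a countable union of closed sets with empty interior) such that for every $p\in\mathcal P\setminus\mathcal P_{\mathrm{fc}}$ the following hold. 1. The fiber $M:=\{c\in\mathcal C:(c,p)\in\mathcal M\}\cong\pi^{-1}(p)$ is a finite-dimensional $C^\infty$ submanifold of $\mathcal C$, and for every $c\in M$ $$\dim T_cM=\operatorname{Ind}(D\pi)_{(c,p)}=\dim\ker (D\pi)_{(c,p)}-\dim\operatorname{coker}(D\pi)_{(c,p)}<\infty .$$ 2. The map $P:=\underline P(\cdot,p):M\to\mathcal F$ is $C^\infty$ and transverse to $\mathcal J$. 3. The preimage $Z:=P^{-1}(\mathcal J)\subset M$ is a $C^\infty$ submanifold of $M$, and for every $c\in Z$ $$\operatorname{codim}_c(Z;M)=\operatorname{codim}_{P(c)}(\mathcal J;\mathcal F)\quad\text{in }\mathbb N\cup\{\infty\}.$$ The codimension of $\mathcal J$ is allowed to be infinite; since $M$ is finite-dimensional, $Z$ then contains no point $c$ at which $\operatorname{codim}_{P(c)}(\mathcal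 J;\mathcal F)=\infty$. -/

import Mathlib

open scoped Manifold ContDiff Topology

noncomputable section

namespace BanachSubmanifold

section Submanifolds

variable {E : Type*} [NormedAddCommGroup E] [NormedSpace ℝ E]
  {H : Type*} [TopologicalSpace H] (I : ModelWithCorners ℝ E H)
  {X : Type*} [TopologicalSpace X] [ChartedSpace H X]

/-- `φ` is a smooth chart of the Banach manifold `X` with values in the model space `E`:
a diffeomorphism of class `C^∞` from an open subset of `X` onto an open subset of `E`. -/
def IsSmoothChart (φ : OpenPartialHomeomorph X E) : Prop :=
  ContMDiffOn I 𝓘(ℝ, E) ∞ φ φ.source ∧ ContMDiffOn 𝓘(ℝ, E) I ∞ φ.symm φ.target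

/-- The subset `S` corresponds to the linear subspace `L` in the chart `φ`. -/
def IsSlice (φ : OpenPartialHomeomorph X E) (S : Set X) (L : Submodule ℝ E) : Prop :=
  ∀ y ∈ φ.source, (y ∈ S ↔ φ y ∈ L)

/-- `S` is a `C^∞` (embedded) Banach submanifold of `X`: near each of its points there is a smooth
chart of `X` in which `S` is a closed linear subspace having a closed complement. -/
def IsSubmanifold (S : Set X) : Prop :=
  ∀ x ∈ S, ∃ (φ : OpenPartialHomeomorph X E) (L : Submodule ℝ E),
    IsSmoothChart I φ ∧ x ∈ φ.source ∧ L.ClosedComplemented ∧ IsSlice φ S L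

/-- `S` is a `C^∞` submanifold of the submanifold `T` of `X`: near each point of `S` there is
a smooth chart of `X` in which `S ⊆ T` become closed complemented linear subspaces `K ≤ L`. -/
def IsSubmanifoldOf (S T : Set X) : Prop :=
  S ⊆ T ∧ ∀ x ∈ S, ∃ (φ : OpenPartialHomeomorph X E) (K L : Submodule ℝ E),
    IsSmoothChart I φ ∧ x ∈ φ.source ∧ K ≤ L ∧ K.ClosedComplemented ∧ L.ClosedComplemented ∧
      IsSlice φ S K ∧ IsSlice φ T L

/-- The tangent space `T_x S ⊆ T_x X` at the point `x` of the submanifold `S` of `X`: the space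
of velocities at time `0` of smooth curves in `X` that run inside `S` and pass through `x` at
time `0`. (When `S` is a submanifold these velocities already form a linear subspace, the subspace
`L` of the definition above, pulled back by the differential of the chart.) -/
def tangentSubspace (S : Set X) (x : X) : Submodule ℝ (TangentSpace I x) :=
  Submodule.span ℝ {v | ∃ γ : ℝ → X, γ 0 = x ∧
    (∃ U ∈ 𝓝 (0 : ℝ), ContMDiffOn 𝓘(ℝ, ℝ) I ∞ γ U ∧ Set.MapsTo γ U S) ∧
    mfderiv 𝓘(ℝ, ℝ) I γ 0 (1 : ℝ) = v}

/-- The codimension in `X`, at the point `x`, of the submanifold `S` of `X`, that is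
`dim (T_x X / T_x S)`, in `ℕ ∪ {∞}`. -/
def codimAt (S : Set X) (x : X) : ℕ∞ :=
  Cardinal.toENat (Module.rank ℝ (TangentSpace I x ⧸ tangentSubspace I S x))

/-- The codimension at `x` of the submanifold `S` of `X` in the larger submanifold `T` of `X`,
that is `dim (T_x T / T_x S)`, in `ℕ ∪ {∞}`. -/
def relCodimAt (S T : Set X) (x : X) : ℕ∞ :=
  Cardinal.toENat (Module.rank ℝ
    (tangentSubspace I T x ⧸ (tangentSubspace I S x).submoduleOf (tangentSubspace I T x)))

end Submanifolds

section Maps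

variable {E : Type*} [NormedAddCommGroup E] [NormedSpace ℝ E]
  {H : Type*} [TopologicalSpace H] (I : ModelWithCorners ℝ E H)
  {X : Type*} [TopologicalSpace X] [ChartedSpace H X]
  {E' : Type*} [NormedAddCommGroup E'] [NormedSpace ℝ E']
  {H' : Type*} [TopologicalSpace H'] (I' : ModelWithCorners ℝ E' H')
  {Y : Type*} [TopologicalSpace Y] [ChartedSpace H' Y]

/-- The differential `T_x S → T_{f x} Y` of the restriction of `f` to the submanifold `S` of `X`.
(`mfderivWithin` is any derivative of `f` at `x` within `S`; its values on the vectors of `T_x S`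
are determined by `f` on `S`, so the composition does not depend on the choice.) -/
def derivAlong (f : X → Y) (S : Set X) (x : X) :
    tangentSubspace I S x →L[ℝ] TangentSpace I' (f x) :=
  (mfderivWithin I I' f S x).comp (tangentSubspace I S x).subtypeL

/-- The restriction of `f` to the submanifold `S` of `X` is transverse to the submanifold `J`
of `Y`: at each `x ∈ S` with `f x ∈ J` the map `T_x S → T_{f x} Y / T_{f x} J` induced by the
differential is onto and its kernel, the preimage of `T_{f x} J`, has a closed complement. -/
def IsTransverseOn (f : X → Y) (S : Set X) (J : Set Y) : Prop :=
  ∀ x ∈ S, f x ∈ J →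
    (derivAlong I I' f S x).range ⊔ tangentSubspace I' J (f x) = ⊤ ∧
    ((tangentSubspace I' J (f x)).comap
      (derivAlong I I' f S x).toLinearMap).ClosedComplemented

/-- The restriction of `f` to the submanifold `S` of `X` is a Fredholm map: all its differentials
are Fredholm operators. -/
def IsFredholmOn (f : X → Y) (S : Set X) : Prop :=
  ∀ x ∈ S, (derivAlong I I' f S x).IsFredholm

/-- The Fredholm index `dim ker - dim coker` at `x` of the restriction of `f` to the
submanifold `S`. -/
def indexAt (f : X → Y) (S : Set X) (x : X) : ℤ :=
  (Module.finrank ℝ (derivAlong I I' f S x).ker : ℤ) -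
    Module.finrank ℝ (TangentSpace I' (f x) ⧸ (derivAlong I I' f S x).range)

end Maps

/-- The fiber over `p` of the projection of `M ⊆ C × P` to `P`, regarded as a subset of `C`. -/
def fiberAt {C P : Type*} (M : Set (C × P)) (p : P) : Set C :=
  {c | (c, p) ∈ M}

end BanachSubmanifold

end

open BanachSubmanifold

/-! Near each of its points `M` is the zero set of a submersion `g` on `C × P`. By transversality,
the part of `M` over `J` is locally the zero set of a submersion `(g, k)`, where `k` is a defining
map of `J` composed with a local extension of `f`. The exceptional set consists of the critical
values of the projection to `P` of `M`, and of its restriction to the preimage of `J`.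

For any other `p`, the maps `g(·, p)` and `(g, k)(·, p)` are split submersions at the relevant
points, so the fiber and the preimage of `J` in it are submanifolds. The projection of `T M` is
onto, so its index is the dimension of its kernel, which is the tangent space of the fiber. For
transversality, take `v` in `T M` hitting a given vector modulo `T J`, and subtract a vector tangent
to the preimage of `J` with the same `P`-component: the difference is tangent to the fiber.

It remains to see that the critical values are meagre. If `J` has infinite codimension, the
projection from its preimage is not Fredholm. A left inverse modulo finite rank of the projection on
`T M` nevertheless restricts to every smaller tangent space, and the Sard–Smale argument is carried
out under this weaker hypothesis. The Lyapunov–Schmidt reduction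
`exists_nhds_isNowhereDense_of_sardProperty` puts the critical values near a point into a closed set
whose slices parallel to `ker S` consist of critical values of maps from a finite-dimensional space
to the Banach space `ker S`. By `sardProperty` these slices are meagre, so the closed set has no
interior. The countable base of `M` passes from local to global. -/

/-! ### Inverse function theorem and straightening of submersions in Banach spaces. -/

section LocalDiffeo

variable {E : Type*} [NormedAddCommGroup E] [NormedSpace ℝ E] [CompleteSpace E]
  {W : Type*} [NormedAddCommGroup W] [NormedSpace ℝ W]

/-- Inverse function theorem for a smooth map tangent to the identity. -/
theorem exists_local_diffeo {Θ : E → E} {U : Set E} (hU : IsOpen U) (hΘ : ContDiffOn ℝ ∞ Θ U)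
    {x₀ : E} (hx₀ : x₀ ∈ U) (h' : fderiv ℝ Θ x₀ = ContinuousLinearMap.id ℝ E) :
    ∃ ψ : OpenPartialHomeomorph E E, x₀ ∈ ψ.source ∧ ψ.source ⊆ U ∧ (∀ x, ψ x = Θ x) ∧
      ContDiffOn ℝ ∞ ψ.symm ψ.target := by
  have hat : ∀ x ∈ U, ContDiffAt ℝ ∞ Θ x := fun x hx => hΘ.contDiffAt (hU.mem_nhds hx)
  have hd : HasFDerivAt Θ ((ContinuousLinearEquiv.refl ℝ E : E ≃L[ℝ] E) : E →L[ℝ] E) x₀ := by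
    have := ((hat x₀ hx₀).differentiableAt (by simp)).hasFDerivAt
    rw [h'] at this
    exact this
  set ψ₀ := (hat x₀ hx₀).toOpenPartialHomeomorph Θ hd (by simp) with hψ₀
  have hc : ContinuousOn (fderiv ℝ Θ) U := hΘ.continuousOn_fderiv_of_isOpen hU (by simp)
  -- Invertibility at `x₀` alone makes the inverse smooth only near one point; on `O` the
  -- differential is invertible everywhere, so the inverse is smooth on the whole target.
  set O := U ∩ fderiv ℝ Θ ⁻¹' Set.range ((↑) : (E ≃L[ℝ] E) → E →L[ℝ] E) with hO
  have hOo : IsOpen O := hc.isOpen_inter_preimage hU ContinuousLinearEquiv.isOpen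
  have hxO : x₀ ∈ O := ⟨hx₀, ⟨ContinuousLinearEquiv.refl ℝ E, by rw [h']; rfl⟩⟩
  refine ⟨ψ₀.restrOpen O hOo, ⟨(hat x₀ hx₀).mem_toOpenPartialHomeomorph_source hd (by simp), hxO⟩,
    fun x hx => hx.2.1, fun x => rfl, ?_⟩
  intro y hy
  apply ContDiffAt.contDiffWithinAt
  have hmem := (ψ₀.restrOpen O hOo).map_target hy
  obtain ⟨e, he⟩ := hmem.2.2
  have h1 : ContDiffAt ℝ ∞ Θ ((ψ₀.restrOpen O hOo).symm y) := hat _ hmem.2.1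
  refine (ψ₀.restrOpen O hOo).contDiffAt_symm hy (f₀' := e) ?_ h1
  rw [he]
  exact (h1.differentiableAt (by simp)).hasFDerivAt

/-- A map with split surjective derivative is linear in a suitable chart. -/
theorem exists_straightening {G : E → W} {U : Set E} (hU : IsOpen U) (hG : ContDiffOn ℝ ∞ G U)
    {x₀ : E} (hx₀ : x₀ ∈ U) (hs : (fderiv ℝ G x₀).HasRightInverse) :
    ∃ ψ : OpenPartialHomeomorph E E, x₀ ∈ ψ.source ∧ ψ.source ⊆ U ∧
      ContDiffOn ℝ ∞ ψ ψ.source ∧ ContDiffOn ℝ ∞ ψ.symm ψ.target ∧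
      fderiv ℝ ψ x₀ = ContinuousLinearMap.id ℝ E ∧ ∀ x, fderiv ℝ G x₀ (ψ x) = G x := by
  obtain ⟨s, hs⟩ := hs
  set A := fderiv ℝ G x₀ with hA
  -- Since `A ∘ s = 1`, this satisfies `A ∘ Θ = G`, and its differential at `x₀` is `s A + (1 - s A)
  -- = 1`.
  set Θ : E → E := fun x => s (G x) + (x - s (A x)) with hΘ
  have hsm : ContDiffOn ℝ ∞ Θ U :=
    (s.contDiff.comp_contDiffOn hG).add
      (contDiffOn_id.sub (s.contDiff.comp_contDiffOn A.contDiff.contDiffOn))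
  have hd : HasFDerivAt Θ (ContinuousLinearMap.id ℝ E) x₀ := by
    have h1 : HasFDerivAt G A x₀ :=
      ((hG.contDiffAt (hU.mem_nhds hx₀)).differentiableAt (by simp)).hasFDerivAt
    have h2 : HasFDerivAt Θ (s.comp A + (ContinuousLinearMap.id ℝ E - s.comp A)) x₀ :=
      (s.hasFDerivAt.comp x₀ h1).add
        ((hasFDerivAt_id x₀).sub (s.hasFDerivAt.comp x₀ A.hasFDerivAt))
    simpa using h2
  obtain ⟨ψ, h1, h2, h3, h4⟩ := exists_local_diffeo hU hsm hx₀ hd.fderiv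
  have h3' : (ψ : E → E) = Θ := funext h3
  refine ⟨ψ, h1, h2, h3' ▸ hsm.mono h2, h4, h3' ▸ hd.fderiv, fun x => ?_⟩
  rw [h3, hΘ]
  simp [hs (G x), hs (A x)]

end LocalDiffeo

/-! ### Lyapunov–Schmidt reduction of the Sard property. -/

section Reduction

/-- If `s` is a right inverse of `T₀`, then `T ∘ s` is close to the identity for `T` near `T₀`,
hence invertible, and `s ∘ (T ∘ s)⁻¹` is a right inverse of `T`. -/
theorem isOpen_setOf_surjective_of_finiteDimensional {K Q : Type*} [NormedAddCommGroup K]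
    [NormedSpace ℝ K] [FiniteDimensional ℝ K] [NormedAddCommGroup Q] [NormedSpace ℝ Q] :
    IsOpen {T : K →L[ℝ] Q | Function.Surjective T} := by
  rw [isOpen_iff_mem_nhds]
  intro T₀ hT₀
  have hT₀' : Function.Surjective (T₀ : K →ₗ[ℝ] Q) := hT₀
  have : FiniteDimensional ℝ Q := Module.Finite.of_surjective _ hT₀'
  have : CompleteSpace Q := FiniteDimensional.complete ℝ Q
  obtain ⟨s, hs⟩ := ContinuousLinearMap.HasRightInverse.of_surjective_of_finiteDimensional hT₀
  have hc : Continuous fun T : K →L[ℝ] Q => T.comp s := by fun_prop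
  have h1 : T₀.comp s = 1 := by ext q; simp [hs q]
  have h2 : {f : Q →L[ℝ] Q | IsUnit f} ∈ 𝓝 (T₀.comp s) :=
    Units.isOpen.mem_nhds (by rw [h1]; exact isUnit_one)
  filter_upwards [hc.continuousAt.preimage_mem_nhds h2] with T hT
  obtain ⟨w, hw⟩ := hT
  intro q
  refine ⟨s ((↑w⁻¹ : Q →L[ℝ] Q) q), ?_⟩
  have h3 : (T.comp s) * (↑w⁻¹ : Q →L[ℝ] Q) = 1 := by
    change (fun T : K →L[ℝ] Q => T.comp s) T * _ = 1
    rw [← hw, Units.mul_inv]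
  exact congrArg (fun f : Q →L[ℝ] Q => f q) h3

variable {V : Type*} [NormedAddCommGroup V] [NormedSpace ℝ V] [CompleteSpace V]
  {Y : Type*} [NormedAddCommGroup Y] [NormedSpace ℝ Y] [CompleteSpace Y]

/-- The property that smooth maps between two normed spaces have meagre sets of critical values. -/
def SardProperty (K Q : Type*) [NormedAddCommGroup K] [NormedSpace ℝ K]
    [NormedAddCommGroup Q] [NormedSpace ℝ Q] : Prop :=
  ∀ (g : K → Q) (O : Set K), IsOpen O → ContDiffOn ℝ ∞ g O →
    IsMeagre (g '' {k ∈ O | ¬ Function.Surjective (fderiv ℝ g k)})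

/-- The Lyapunov–Schmidt reduction of the Sard property: if `S` is a partial inverse of the
differential of `u` at `x₀` up to finite dimensions, the critical values of `u` near `x₀` are
controlled by those of maps between `ker (S ∘ T)` and `ker S`. -/
theorem exists_nhds_isNowhereDense_of_sardProperty {u : V → Y} {U : Set V} (hU : IsOpen U)
    (hu : ContDiffOn ℝ ∞ u U) {x₀ : V} (hx₀ : x₀ ∈ U) (S : Y →L[ℝ] V)
    (hS : ∀ y, S (fderiv ℝ u x₀ (S y)) = S y)
    (hfin : FiniteDimensional ℝ (S.comp (fderiv ℝ u x₀)).ker)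
    (sard : SardProperty (S.comp (fderiv ℝ u x₀)).ker S.ker) :
    ∃ N ∈ 𝓝 x₀, IsNowhereDense (u '' {x ∈ N | ¬ Function.Surjective (fderiv ℝ u x)}) := by
  set T := fderiv ℝ u x₀ with hT
  set p : V →L[ℝ] V := S.comp T with hp
  have hpp : ∀ v, p (p v) = p v := fun v => hS (T v)
  have hpS : ∀ y, p (S y) = S y := hS
  -- Here `p` is a projection with the same range as `S`. In the coordinates `Θ` the map `S ∘ u`
  -- becomes the linear map `p`, so the nonlinearity of `u` is confined to `ker S`.
  set Θ : V → V := fun x => S (u x) + (x - p x) with hΘ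
  have hsm : ContDiffOn ℝ ∞ Θ U :=
    (S.contDiff.comp_contDiffOn hu).add (contDiffOn_id.sub p.contDiff.contDiffOn)
  have hd : HasFDerivAt Θ (ContinuousLinearMap.id ℝ V) x₀ := by
    have h1 : HasFDerivAt u T x₀ :=
      ((hu.contDiffAt (hU.mem_nhds hx₀)).differentiableAt (by simp)).hasFDerivAt
    have h2 : HasFDerivAt Θ (S.comp T + (ContinuousLinearMap.id ℝ V - p)) x₀ :=
      (S.hasFDerivAt.comp x₀ h1).add ((hasFDerivAt_id x₀).sub p.hasFDerivAt)
    simpa [hp] using h2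
  obtain ⟨ψ, hψx, hψU, hψΘ, hψs⟩ := exists_local_diffeo hU hsm hx₀ hd.fderiv
  have hψ' : (ψ : V → V) = Θ := funext hψΘ
  set v₀ := ψ x₀ with hv₀
  have hv₀t : v₀ ∈ ψ.target := ψ.map_source hψx
  set u' : V → Y := fun v => u (ψ.symm v) with hu'
  have hu's : ContDiffOn ℝ ∞ u' ψ.target :=
    hu.comp hψs (fun v hv => hψU (ψ.map_target hv))
  have hSu : ∀ v ∈ ψ.target, S (u' v) = p v := by
    intro v hv
    have h1 : Θ (ψ.symm v) = v := by rw [← hψΘ]; exact ψ.right_inv hv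
    have h2 : p (Θ (ψ.symm v)) = S (u' v) := by
      simp only [hΘ, map_add, map_sub, hpS, hpp, hu', sub_self, add_zero]
    rw [← h2, h1]
  have hSdu : ∀ v ∈ ψ.target, ∀ w, S (fderiv ℝ u' v w) = p w := by
    intro v hv w
    have hdu : HasFDerivAt u' (fderiv ℝ u' v) v :=
      ((hu's.contDiffAt (ψ.open_target.mem_nhds hv)).differentiableAt (by simp)).hasFDerivAt
    have h1 : HasFDerivAt (fun z => S (u' z)) (S.comp (fderiv ℝ u' v)) v :=
      S.hasFDerivAt.comp v hdu
    have h2 : (fun z => S (u' z)) =ᶠ[𝓝 v] p := by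
      filter_upwards [ψ.open_target.mem_nhds hv] with z hz using hSu z hz
    have h3 := (p.hasFDerivAt (x := v)).unique (h1.congr_of_eventuallyEq h2.symm)
    exact (congrArg (fun f : V →L[ℝ] V => f w) h3).symm
  set K := p.ker with hK
  set Q := S.ker with hQ
  -- The projection of `Y` onto `ker S` along the range of `T ∘ S`.
  set q : Y →L[ℝ] Q := (ContinuousLinearMap.id ℝ Y - T.comp S).codRestrict Q
    (fun y => by simp [hQ, hS]) with hq
  have hqv : ∀ y, (q y : Y) = y - T (S y) := fun y => rfl
  have hqQ : ∀ z : Q, q z = z := by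
    intro z
    apply Subtype.ext
    have : S (z : Y) = 0 := z.2
    rw [hqv, this, map_zero, sub_zero]
  set Dm : V → (K →L[ℝ] Q) := fun v => (q.comp (fderiv ℝ u' v)).comp K.subtypeL with hDm
  have hDmc : ContinuousOn Dm ψ.target := by
    have h1 : ContinuousOn (fderiv ℝ u') ψ.target :=
      hu's.continuousOn_fderiv_of_isOpen ψ.open_target (by simp)
    have h2 : Continuous fun f : V →L[ℝ] Y => (q.comp f).comp K.subtypeL := by fun_prop
    exact h2.comp_continuousOn h1
  -- For the splittings `V = range S ⊕ K` and `Y = range (T ∘ S) ⊕ Q`, the differential of `u'` is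
  -- block triangular, with an isomorphism in the first diagonal block and `Dm v` in the second.
  have hsurj : ∀ v ∈ ψ.target, Function.Surjective (Dm v) →
      Function.Surjective (fderiv ℝ u (ψ.symm v)) := by
    intro v hv hs y
    have hchain : fderiv ℝ u' v = (fderiv ℝ u (ψ.symm v)).comp (fderiv ℝ ψ.symm v) := by
      refine fderiv_comp (g := u) v ?_ ?_
      · exact (hu.contDiffAt (hU.mem_nhds (hψU (ψ.map_target hv)))).differentiableAt (by simp)
      · exact (hψs.contDiffAt (ψ.open_target.mem_nhds hv)).differentiableAt (by simp)
    obtain ⟨k, hk⟩ := hs (q (y - fderiv ℝ u' v (S y)))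
    refine ⟨fderiv ℝ ψ.symm v (S y + k), ?_⟩
    have h0 : fderiv ℝ u' v (S y + k) = y := by
      have h1 : S (fderiv ℝ u' v (k : V)) = 0 := by rw [hSdu v hv]; exact k.2
      have h2 : S (y - fderiv ℝ u' v (S y)) = 0 := by rw [map_sub, hSdu v hv, hpS, sub_self]
      have h3 : (q (fderiv ℝ u' v (k : V)) : Y) = q (y - fderiv ℝ u' v (S y)) :=
        congrArg Subtype.val hk
      rw [hqv, hqv, h1, h2, map_zero, sub_zero, sub_zero] at h3
      rw [map_add, h3, add_sub_cancel]
    rw [hchain] at h0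
    exact h0
  obtain ⟨δ, hδ, hball⟩ := Metric.isOpen_iff.1 ψ.open_target v₀ hv₀t
  set ε := δ / 3 with hε
  have hεp : 0 < ε := by positivity
  set k₀ : K := ⟨v₀ - p v₀, by simp [hK, hpp]⟩ with hk₀
  have htarget : ∀ k : K, ∀ r : V, ‖k - k₀‖ ≤ ε → ‖r - p v₀‖ ≤ ε → (k : V) + r ∈ ψ.target := by
    intro k r h1 h2
    apply hball
    rw [Metric.mem_ball, dist_eq_norm]
    have h1' : ‖(k : V) - (v₀ - p v₀)‖ ≤ ε := h1
    calc ‖(k : V) + r - v₀‖ = ‖((k : V) - (v₀ - p v₀)) + (r - p v₀)‖ := by congr 1; abel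
      _ ≤ ε + ε := (norm_add_le _ _).trans (add_le_add h1' h2)
      _ < δ := by rw [hε]; linarith
  have : ProperSpace K := FiniteDimensional.proper ℝ K
  set B := Metric.closedBall k₀ ε with hB
  have : CompactSpace B := isCompact_iff_compactSpace.1 (isCompact_closedBall k₀ ε)
  set D : Set (B × Y) := {z | ‖S z.2 - p v₀‖ ≤ ε} with hD
  have hDc : IsClosed D := isClosed_le (by fun_prop) continuous_const
  set add : B × Y → V := fun z => ((z.1 : K) : V) + S z.2 with hadd
  have hac : Continuous add := by fun_prop
  have hat : Set.MapsTo add D ψ.target := by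
    intro z hz
    exact htarget _ _ ((dist_eq_norm _ _).symm.trans_le z.1.2) hz
  -- If `u' v = y`, then `p v = S y`, so `v = k + S y` with only `k ∈ K` unknown. As `k` is confined
  -- to the compact ball `B`, the projection of this closed set to `Y` is closed.
  set Z : Set (B × Y) := (D ∩ (fun z => (u' (add z), z.2)) ⁻¹' Set.diagonal Y) ∩
    (D ∩ (fun z => Dm (add z)) ⁻¹' {T : K →L[ℝ] Q | Function.Surjective T}ᶜ) with hZ
  have hZc : IsClosed Z := by
    apply IsClosed.inter
    · refine ContinuousOn.preimage_isClosed_of_isClosed ?_ hDc isClosed_diagonal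
      exact (hu's.continuousOn.comp hac.continuousOn hat).prodMk continuousOn_snd
    · refine ContinuousOn.preimage_isClosed_of_isClosed ?_ hDc
        isOpen_setOf_surjective_of_finiteDimensional.isClosed_compl
      exact hDmc.comp hac.continuousOn hat
  set A := Prod.snd '' Z with hA
  have hAc : IsClosed A := isClosedMap_snd_of_compactSpace _ hZc
  have hAi : interior A = ∅ := by
    rw [Set.eq_empty_iff_forall_notMem]
    -- On the slice `y₀ + ker S` the value `S y = r` is fixed, and `q` carries points of `A` to
    -- critical values of the single map `g : K → Q`. By Baire these cannot fill a nonempty open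
    -- subset of the complete space `Q`.
    intro y₀ hy₀
    set r := S y₀ with hr
    set g : K → Q := fun k => q (u' ((k : V) + r)) with hg
    set O : Set K := (fun k : K => (k : V) + r) ⁻¹' ψ.target with hO
    have hOo : IsOpen O := ψ.open_target.preimage (by fun_prop)
    have hcd : ContDiff ℝ ∞ fun k : K => (k : V) + r :=
      K.subtypeL.contDiff.add contDiff_const
    have hgs : ContDiffOn ℝ ∞ g O :=
      q.contDiff.comp_contDiffOn (hu's.comp hcd.contDiffOn (fun k hk => hk))
    have hgd : ∀ k ∈ O, fderiv ℝ g k = Dm (k + r) := by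
      intro k hk
      have h1 : HasFDerivAt u' (fderiv ℝ u' (k + r)) ((k : V) + r) :=
        ((hu's.contDiffAt (ψ.open_target.mem_nhds hk)).differentiableAt (by simp)).hasFDerivAt
      have h2 : HasFDerivAt (fun k : K => (k : V) + r) K.subtypeL k :=
        K.subtypeL.hasFDerivAt.add_const r
      exact (q.hasFDerivAt.comp k (h1.comp k h2)).fderiv
    have hm := sard g O hOo hgs
    have hdense := dense_of_mem_residual hm
    have hopen : IsOpen {z : Q | y₀ + ((z - q y₀ : Q) : Y) ∈ interior A} :=
      isOpen_interior.preimage (by fun_prop)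
    obtain ⟨z, hz1, hz2⟩ := hdense.inter_open_nonempty _ hopen ⟨q y₀, by simpa using hy₀⟩
    apply hz2
    obtain ⟨⟨k, y⟩, ⟨⟨hk1, hk2⟩, hk3, hk4⟩, rfl : y = _⟩ := interior_subset hz1
    have hSz : S (y₀ + ((z - q y₀ : Q) : Y)) = r := by
      have : S ((z - q y₀ : Q) : Y) = 0 := (z - q y₀ : Q).2
      rw [map_add, this, add_zero]
    simp only [hadd, Set.mem_preimage, Set.mem_diagonal_iff, hSz] at hk2 hk4
    have hkO : (k : K) ∈ O := by
      have := hat hk1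
      simp only [hadd, hSz] at this
      exact this
    refine ⟨k, ⟨hkO, ?_⟩, ?_⟩
    · rw [hgd _ hkO]; exact hk4
    · simp only [hg, hk2, map_add, hqQ, add_sub_cancel]
  refine ⟨ψ.source ∩ ψ ⁻¹' {v | ‖v - p v - (v₀ - p v₀)‖ < ε ∧ ‖p v - p v₀‖ < ε}, ?_, ?_⟩
  · refine Filter.inter_mem (ψ.open_source.mem_nhds hψx) ?_
    refine (ψ.continuousAt hψx).preimage_mem_nhds (IsOpen.mem_nhds ?_ ?_)
    · have h1 : Continuous fun v : V => ‖v - p v - (v₀ - p v₀)‖ := by fun_prop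
      have h2 : Continuous fun v : V => ‖p v - p v₀‖ := by fun_prop
      exact (isOpen_lt h1 continuous_const).inter (isOpen_lt h2 continuous_const)
    · simpa [hv₀] using hεp
  · have hsub : u '' {x ∈ ψ.source ∩ ψ ⁻¹' {v | ‖v - p v - (v₀ - p v₀)‖ < ε ∧ ‖p v - p v₀‖ < ε} |
        ¬ Function.Surjective (fderiv ℝ u x)} ⊆ A := by
      rintro _ ⟨x, ⟨⟨hx1, hx2, hx3⟩, hx4⟩, rfl⟩
      have hxt := ψ.map_source hx1
      have hux : u' (ψ x) = u x := by simp only [hu', ψ.left_inv hx1]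
      have hSx : S (u x) = p (ψ x) := by rw [← hux, hSu _ hxt]
      set k : K := ⟨ψ x - p (ψ x), by simp [hK, hpp]⟩ with hk
      have hkB : k ∈ B := by
        rw [hB, Metric.mem_closedBall, dist_eq_norm]
        exact hx2.le
      have haddx : add (⟨k, hkB⟩, u x) = ψ x := by simp [hadd, hk, hSx]
      have hmD : ((⟨k, hkB⟩, u x) : B × Y) ∈ D := by
        simp only [hD, Set.mem_ofPred_eq, hSx]; exact hx3.le
      refine ⟨(⟨k, hkB⟩, u x), ⟨⟨hmD, ?_⟩, hmD, ?_⟩, rfl⟩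
      · simp only [Set.mem_preimage, haddx, hux, Set.mem_diagonal_iff]
      · simp only [Set.mem_preimage, haddx]
        intro hs
        have := hsurj _ hxt hs
        rw [ψ.left_inv hx1] at this
        exact hx4 this
    rw [IsNowhereDense]
    exact Set.subset_eq_empty (interior_mono (closure_minimal hsub hAc)) hAi

end Reduction

/-! ### Sard's theorem from finite-dimensional spaces to Banach spaces. -/

section Sard

/-- By the Lindelöf property, countably many of the neighborhoods cover `s`. -/
theorem isMeagre_image_of_forall_exists_nhds {X Y : Type*} [TopologicalSpace X]
    [SecondCountableTopology X] [TopologicalSpace Y] {g : X → Y} {s : Set X}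
    (h : ∀ x ∈ s, ∃ t ∈ 𝓝 x, IsMeagre (g '' (t ∩ s))) : IsMeagre (g '' s) := by
  choose! t ht hm using h
  obtain ⟨I, hIs, hIc, hcov⟩ :=
    TopologicalSpace.countable_cover_nhdsWithin fun x hx => mem_nhdsWithin_of_mem_nhds (ht x hx)
  refine (isMeagre_biUnion hIc fun x hx => hm x (hIs hx)).mono ?_
  rintro _ ⟨x, hx, rfl⟩
  obtain ⟨i, hi, hxi⟩ := Set.mem_iUnion₂.1 (hcov hx)
  exact Set.mem_iUnion₂.2 ⟨i, hi, x, ⟨hxi, hx⟩, rfl⟩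

/-- A compact set with an interior point would make `Q` locally compact, hence finite-dimensional.
-/
theorem IsCompact.isNowhereDense_of_not_finiteDimensional {Q : Type*} [NormedAddCommGroup Q]
    [NormedSpace ℝ Q] (hQ : ¬ FiniteDimensional ℝ Q) {s : Set Q} (hs : IsCompact s) :
    IsNowhereDense s := by
  rw [hs.isClosed.isNowhereDense_iff, Set.eq_empty_iff_forall_notMem]
  intro x hx
  have : LocallyCompactSpace Q :=
    hs.locallyCompactSpace_of_mem_nhds_of_addGroup (mem_interior_iff_mem_nhds.1 hx)
  exact hQ (FiniteDimensional.of_locallyCompactSpace ℝ)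

variable {K : Type*} [NormedAddCommGroup K] [NormedSpace ℝ K]
  {Q : Type*} [NormedAddCommGroup Q] [NormedSpace ℝ Q]

/-- Taylor estimate at a point where all derivatives vanish. -/
theorem norm_iteratedFDeriv_le_of_flat {g : K → Q} {B : Set K} (hB : Convex ℝ B)
    (hg : ∀ x ∈ B, ContDiffAt ℝ ∞ g x) {x : K} (hx : x ∈ B)
    (hflat : ∀ j : ℕ, iteratedFDeriv ℝ (j + 1) g x = 0) {n : ℕ} {c : ℝ}
    (hc : ∀ y ∈ B, ‖iteratedFDeriv ℝ (n + 1) g y‖ ≤ c) :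
    ∀ i j : ℕ, i + j = n → ∀ y ∈ B, ‖iteratedFDeriv ℝ (j + 1) g y‖ ≤ c * ‖y - x‖ ^ i := by
  have hc0 : 0 ≤ c := (norm_nonneg _).trans (hc x hx)
  intro i
  induction i with
  | zero =>
    intro j hj y hy
    obtain rfl : j = n := by omega
    simpa using hc y hy
  -- The derivative of order `j + 1` vanishes at `x`, so the mean value inequality on the part of
  -- `B` within distance `‖y - x‖` of `x` gains one power over the bound for order `j + 2`.
  | succ i ih =>
    intro j hj y hy
    have h1 : ∀ z ∈ B ∩ Metric.closedBall x ‖y - x‖,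
        ‖fderiv ℝ (iteratedFDeriv ℝ (j + 1) g) z‖ ≤ c * ‖y - x‖ ^ i := by
      intro z hz
      rw [norm_fderiv_iteratedFDeriv]
      have hzx : ‖z - x‖ ≤ ‖y - x‖ := by simpa [dist_eq_norm] using hz.2
      exact (ih (j + 1) (by omega) z hz.1).trans (by gcongr)
    have h2 := Convex.norm_image_sub_le_of_norm_fderiv_le (𝕜 := ℝ)
      (fun z hz => (hg z hz.1).differentiableAt_iteratedFDeriv
        (by exact_mod_cast WithTop.coe_lt_coe.2 (WithTop.coe_lt_top _)))
      h1 (hB.inter (convex_closedBall x _))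
      ⟨hx, Metric.mem_closedBall_self (norm_nonneg _)⟩
      ⟨hy, by simp [dist_eq_norm]⟩
    rw [hflat, sub_zero] at h2
    rwa [pow_succ, ← mul_assoc]

theorem norm_sub_le_of_flat {g : K → Q} {B : Set K} (hB : Convex ℝ B)
    (hg : ∀ x ∈ B, ContDiffAt ℝ ∞ g x) {x : K} (hx : x ∈ B)
    (hflat : ∀ j : ℕ, iteratedFDeriv ℝ (j + 1) g x = 0) {n : ℕ} {c : ℝ}
    (hc : ∀ y ∈ B, ‖iteratedFDeriv ℝ (n + 1) g y‖ ≤ c) {y : K} (hy : y ∈ B) :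
    ‖g y - g x‖ ≤ c * ‖y - x‖ ^ (n + 1) := by
  have hc0 : 0 ≤ c := (norm_nonneg _).trans (hc x hx)
  have h1 : ∀ z ∈ B ∩ Metric.closedBall x ‖y - x‖, ‖fderiv ℝ g z‖ ≤ c * ‖y - x‖ ^ n := by
    intro z hz
    rw [← norm_iteratedFDeriv_one]
    have hzx : ‖z - x‖ ≤ ‖y - x‖ := by simpa [dist_eq_norm] using hz.2
    exact (norm_iteratedFDeriv_le_of_flat hB hg hx hflat hc n 0 (by omega) z hz.1).trans
      (by gcongr)
  have h2 := Convex.norm_image_sub_le_of_norm_fderiv_le (𝕜 := ℝ)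
    (fun z hz => (hg z hz.1).differentiableAt (by simp))
    h1 (hB.inter (convex_closedBall x _))
    ⟨hx, Metric.mem_closedBall_self (norm_nonneg _)⟩
    ⟨hy, by simp [dist_eq_norm]⟩
  rwa [pow_succ, ← mul_assoc]

theorem continuousOn_iteratedFDeriv_of_contDiffAt {g : K → Q} {B : Set K}
    (hg : ∀ x ∈ B, ContDiffAt ℝ ∞ g x) (n : ℕ) : ContinuousOn (iteratedFDeriv ℝ n g) B :=
  fun x hx => ((hg x hx).continuousAt_iteratedFDeriv
    (by exact_mod_cast WithTop.coe_le_coe.2 le_top)).continuousWithinAt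

/-- Points where all derivatives vanish have a meagre image. -/
theorem isMeagre_image_flat [FiniteDimensional ℝ K] [FiniteDimensional ℝ Q] [Nontrivial Q]
    {g : K → Q} {U : Set K} (hU : IsOpen U) (hg : ContDiffOn ℝ ∞ g U) :
    IsMeagre (g '' {x ∈ U | ∀ j : ℕ, iteratedFDeriv ℝ (j + 1) g x = 0}) := by
  have : ProperSpace K := FiniteDimensional.proper ℝ K
  have hat : ∀ x ∈ U, ContDiffAt ℝ ∞ g x := fun x hx => hg.contDiffAt (hU.mem_nhds hx)
  set s := {x ∈ U | ∀ j : ℕ, iteratedFDeriv ℝ (j + 1) g x = 0} with hs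
  refine isMeagre_image_of_forall_exists_nhds fun x₀ hx₀ => ?_
  obtain ⟨ε, hε, hball⟩ := Metric.nhds_basis_closedBall.mem_iff.1 (hU.mem_nhds hx₀.1)
  refine ⟨Metric.closedBall x₀ ε, Metric.closedBall_mem_nhds _ hε, IsNowhereDense.isMeagre ?_⟩
  set B := Metric.closedBall x₀ ε with hBdef
  have hBc : IsCompact B := isCompact_closedBall _ _
  have hBat : ∀ x ∈ B, ContDiffAt ℝ ∞ g x := fun x hx => hat x (hball hx)
  -- Flatness gives a Hölder estimate of any order. Order `n + 1` suffices: the image then has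
  -- Hausdorff dimension at most `n / (n + 1) < 1 ≤ dim Q`.
  set n := Module.finrank ℝ K with hn
  obtain ⟨c, hc⟩ := hBc.exists_bound_of_continuousOn
    (continuousOn_iteratedFDeriv_of_contDiffAt hBat (n + 1))
  have hc0 : 0 ≤ c := (norm_nonneg _).trans (hc x₀ (Metric.mem_closedBall_self hε.le))
  have hBs : IsClosed (B ∩ s) := by
    have : B ∩ s = ⋂ j : ℕ, B ∩ iteratedFDeriv ℝ (j + 1) g ⁻¹' {0} := by
      ext x
      simp only [hs, Set.mem_inter_iff, Set.mem_ofPred_eq, Set.mem_iInter, Set.mem_preimage,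
        Set.mem_singleton_iff]
      exact ⟨fun h j => ⟨h.1, h.2.2 j⟩, fun h => ⟨(h 0).1, hball (h 0).1, fun j => (h j).2⟩⟩
    rw [this]
    exact isClosed_iInter fun j =>
      (continuousOn_iteratedFDeriv_of_contDiffAt hBat (j + 1)).preimage_isClosed_of_isClosed
        Metric.isClosed_closedBall isClosed_singleton
  have hcomp : IsCompact (g '' (B ∩ s)) :=
    (hBc.of_isClosed_subset hBs Set.inter_subset_left).image_of_continuousOn
      fun x hx => (hBat x hx.1).continuousAt.continuousWithinAt
  rw [hcomp.isClosed.isNowhereDense_iff, interior_eq_empty_iff_dense_compl]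
  apply dense_compl_of_dimH_lt_finrank
  have hH : HolderOnWith c.toNNReal ((n + 1 : ℕ) : NNReal) g (B ∩ s) := by
    intro y hy x hx
    have h1 := norm_sub_le_of_flat (convex_closedBall x₀ ε) hBat hx.1 hx.2.2 hc hy.1
    rw [edist_dist, edist_dist, dist_eq_norm, dist_eq_norm, NNReal.coe_natCast,
      ENNReal.rpow_natCast, ← ENNReal.ofReal_pow (norm_nonneg _),
      ← ENNReal.ofReal, ← ENNReal.ofReal_mul hc0]
    exact ENNReal.ofReal_le_ofReal h1
  have h2 := hH.dimH_image_le (by positivity)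
  have h3 : dimH (B ∩ s) ≤ n :=
    (dimH_mono (Set.subset_univ _)).trans (Real.dimH_univ_eq_finrank K).le
  have h4 : (1 : ENNReal) ≤ Module.finrank ℝ Q := by
    exact_mod_cast Module.finrank_pos (R := ℝ) (M := Q)
  refine (h2.trans (ENNReal.div_le_div_right h3 _)).trans_lt (lt_of_lt_of_le ?_ h4)
  rw [ENNReal.div_lt_iff (by left; positivity) (by left; simp)]
  rw [one_mul]
  exact_mod_cast Nat.lt_succ_self n

universe u v

/-- Induction on `dim K`, with both spaces left general because the reductions pass to proper
subspaces of `K` and may replace `Q` by a subspace. For nonzero finite-dimensional `Q`, the critical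
points are split by whether the first derivative is nonzero, it vanishes but a higher one does not,
or all of them vanish. -/
theorem sardProperty_aux (n : ℕ) : ∀ (K : Type u) [NormedAddCommGroup K] [NormedSpace ℝ K]
    [FiniteDimensional ℝ K] (Q : Type v) [NormedAddCommGroup Q] [NormedSpace ℝ Q]
    [CompleteSpace Q], Module.finrank ℝ K = n → SardProperty K Q := by
  induction n using Nat.strong_induction_on with
  | _ n ih =>
  intro K _ _ _ Q _ _ _ hn g U hU hg
  have : ProperSpace K := FiniteDimensional.proper ℝ K
  have : CompleteSpace K := FiniteDimensional.complete ℝ K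
  have hat : ∀ x ∈ U, ContDiffAt ℝ ∞ g x := fun x hx => hg.contDiffAt (hU.mem_nhds hx)
  have ih' : ∀ (L : Submodule ℝ K), L ≠ ⊤ → ∀ (Q : Type v) [NormedAddCommGroup Q]
      [NormedSpace ℝ Q] [CompleteSpace Q], SardProperty L Q := fun L hL Q _ _ _ =>
    ih _ (hn ▸ Submodule.finrank_lt hL) L Q rfl
  by_cases hQ : FiniteDimensional ℝ Q
  swap
  -- For infinite-dimensional `Q` criticality is irrelevant: the image of a closed ball is compact,
  -- hence nowhere dense.
  · refine isMeagre_image_of_forall_exists_nhds fun x₀ hx₀ => ?_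
    obtain ⟨ε, hε, hball⟩ := Metric.nhds_basis_closedBall.mem_iff.1 (hU.mem_nhds hx₀.1)
    refine ⟨Metric.closedBall x₀ ε, Metric.closedBall_mem_nhds _ hε, ?_⟩
    have hc : IsCompact (g '' Metric.closedBall x₀ ε) :=
      (isCompact_closedBall _ _).image_of_continuousOn
        fun x hx => (hat x (hball hx)).continuousAt.continuousWithinAt
    exact (hc.isNowhereDense_of_not_finiteDimensional hQ).isMeagre.mono
      (Set.image_mono Set.inter_subset_left)
  rcases subsingleton_or_nontrivial Q with hQ1 | hQ1
  · convert IsMeagre.empty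
    rw [Set.image_eq_empty, Set.eq_empty_iff_forall_notMem]
    exact fun x hx => hx.2 fun y => ⟨0, Subsingleton.elim _ _⟩
  have h0 : IsMeagre (g '' {x ∈ U | ¬ Function.Surjective (fderiv ℝ g x) ∧ fderiv ℝ g x ≠ 0}) := by
    refine isMeagre_image_of_forall_exists_nhds fun x₀ hx₀ => ?_
    obtain ⟨v, hv⟩ : ∃ v, fderiv ℝ g x₀ v ≠ 0 := by
      by_contra! h
      exact hx₀.2.2 (ContinuousLinearMap.ext h)
    obtain ⟨ℓ, hℓ⟩ := SeparatingDual.exists_eq_one (R := ℝ) hv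
    -- A rank-one partial inverse is enough: the reduced domain `ker (S ∘ T)` misses `v`, so its
    -- dimension is smaller and the induction hypothesis applies.
    set S : Q →L[ℝ] K := ℓ.smulRight v with hS
    have hSy : ∀ y, S y = ℓ y • v := fun y => rfl
    have hker : (S.comp (fderiv ℝ g x₀)).ker ≠ ⊤ := by
      intro h
      have h1 : v ∈ (S.comp (fderiv ℝ g x₀)).ker := h ▸ Submodule.mem_top
      have h2 : S (fderiv ℝ g x₀ v) = 0 := h1
      rw [hSy, hℓ, one_smul] at h2
      exact hv (by rw [h2, map_zero])
    have : CompleteSpace S.ker := S.isClosed_ker.completeSpace_coe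
    obtain ⟨N, hN, hN'⟩ := exists_nhds_isNowhereDense_of_sardProperty hU hg hx₀.1 S
      (fun y => by rw [hSy y, map_smul, map_smul, hSy, hℓ, one_smul]) inferInstance
      (ih' _ hker S.ker)
    refine ⟨N, hN, (hN'.mono ?_).isMeagre⟩
    exact Set.image_mono fun x hx => ⟨hx.1, hx.2.2.1⟩
  have h1 : ∀ k : ℕ, IsMeagre (g '' {x ∈ U | fderiv ℝ g x = 0 ∧ iteratedFDeriv ℝ k g x = 0 ∧
      iteratedFDeriv ℝ (k + 1) g x ≠ 0}) := by
    intro k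
    refine isMeagre_image_of_forall_exists_nhds fun x₀ hx₀ => ?_
    obtain ⟨v, hv⟩ : ∃ v, fderiv ℝ (iteratedFDeriv ℝ k g) x₀ v ≠ 0 := by
      by_contra! h
      refine hx₀.2.2.2 (ContinuousMultilinearMap.ext fun m => ?_)
      rw [iteratedFDeriv_succ_apply_left, h]
      rfl
    obtain ⟨ℓ, hℓ⟩ := SeparatingDual.exists_eq_one (R := ℝ) hv
    -- Near `x₀` this stratum lies in the hypersurface `w = 0`. The differential of `g` vanishes on
    -- the stratum, so its points stay critical for the restriction of `g` to the hypersurface,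
    -- whose model `L` has smaller dimension.
    set w : K → ℝ := fun x => ℓ (iteratedFDeriv ℝ k g x) with hw
    have hiter : ∀ x ∈ U, ContDiffAt ℝ ∞ (iteratedFDeriv ℝ k g) x := fun x hx =>
      (hat x hx).iteratedFDeriv_right (by exact_mod_cast le_top)
    have hws : ContDiffOn ℝ ∞ w U := fun x hx =>
      (ℓ.contDiff.contDiffAt.comp x (hiter x hx)).contDiffWithinAt
    have hwd : fderiv ℝ w x₀ v = 1 := by
      have h2 : HasFDerivAt w (ℓ.comp (fderiv ℝ (iteratedFDeriv ℝ k g) x₀)) x₀ :=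
        ℓ.hasFDerivAt.comp x₀ ((hiter x₀ hx₀.1).differentiableAt (by simp)).hasFDerivAt
      rw [h2.fderiv]
      exact hℓ
    have hwr : (fderiv ℝ w x₀).HasRightInverse :=
      ⟨(ContinuousLinearMap.id ℝ ℝ).smulRight v, fun y => by simp [hwd]⟩
    obtain ⟨ψ, hψx, hψU, hψ1, hψ2, -, hψw⟩ := exists_straightening hU hws hx₀.1 hwr
    set L := (fderiv ℝ w x₀).ker with hL
    have hLt : L ≠ ⊤ := by
      intro h
      have h2 : v ∈ L := h ▸ Submodule.mem_top
      have h3 : fderiv ℝ w x₀ v = 0 := h2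
      rw [hwd] at h3
      exact one_ne_zero h3
    refine ⟨ψ.source, ψ.open_source.mem_nhds hψx, ?_⟩
    have hOo : IsOpen (L.subtypeL ⁻¹' ψ.target) := ψ.open_target.preimage L.subtypeL.continuous
    have hψ2' : ContDiffOn ℝ ∞ (fun l : L => ψ.symm l) (L.subtypeL ⁻¹' ψ.target) :=
      hψ2.comp L.subtypeL.contDiff.contDiffOn fun l hl => hl
    refine (ih' L hLt Q (fun l => g (ψ.symm l)) _ hOo
      (hg.comp hψ2' fun l hl => hψU (ψ.map_target hl))).mono ?_
    rintro _ ⟨x, ⟨hxψ, hxU, hx1, hx2, -⟩, rfl⟩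
    have hxL : ψ x ∈ L := by
      change fderiv ℝ w x₀ (ψ x) = 0
      rw [hψw, hw]
      simp [hx2]
    have hxO : (⟨ψ x, hxL⟩ : L) ∈ L.subtypeL ⁻¹' ψ.target := ψ.map_source hxψ
    refine ⟨⟨ψ x, hxL⟩, ⟨hxO, ?_⟩, by simp [ψ.left_inv hxψ]⟩
    have hd : HasFDerivAt g (0 : K →L[ℝ] Q) (ψ.symm (⟨ψ x, hxL⟩ : L)) := by
      simp only [ψ.left_inv hxψ]
      rw [← hx1]
      exact ((hat x hxU).differentiableAt (by simp)).hasFDerivAt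
    have hd2 := ((hψ2'.contDiffAt (hOo.mem_nhds hxO)).differentiableAt (by simp)).hasFDerivAt
    have hd3 : fderiv ℝ (fun l : L => g (ψ.symm l)) ⟨ψ x, hxL⟩ = 0 :=
      (HasFDerivAt.comp (g := g) (f := fun l : L => ψ.symm l) _ hd hd2).fderiv.trans
        (ContinuousLinearMap.zero_comp _)
    rw [hd3]
    intro hs
    obtain ⟨q, hq⟩ := exists_ne (0 : Q)
    obtain ⟨l, hl⟩ := hs q
    exact hq hl.symm
  refine ((h0.union (isMeagre_iUnion h1)).union (isMeagre_image_flat hU hg)).mono ?_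
  rintro _ ⟨x, ⟨hxU, hx⟩, rfl⟩
  by_cases hx0 : fderiv ℝ g x = 0
  · by_cases hf : ∀ j : ℕ, iteratedFDeriv ℝ (j + 1) g x = 0
    · exact Or.inr ⟨x, ⟨hxU, hf⟩, rfl⟩
    · push Not at hf
      classical
      -- The least `j` with nonzero derivative of order `j + 1`. It is positive because the first
      -- derivative vanishes, so by minimality the derivative of order `j = i + 1` is zero.
      set j := Nat.find hf with hj
      have hj1 := Nat.find_spec hf
      obtain ⟨i, hi⟩ : ∃ i, j = i + 1 := by
        refine Nat.exists_eq_succ_of_ne_zero fun h => hj1 ?_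
        rw [← norm_eq_zero, ← hj, h, zero_add, norm_iteratedFDeriv_one, hx0, norm_zero]
      have hi1 : iteratedFDeriv ℝ (i + 1) g x = 0 := by
        have := Nat.find_min hf (m := i) (by omega)
        simpa using this
      refine Or.inl (Or.inr (Set.mem_iUnion.2 ⟨j, x, ⟨hxU, hx0, ?_, hj1⟩, rfl⟩))
      rw [hi]; exact hi1
  · exact Or.inl (Or.inl ⟨x, ⟨hxU, hx, hx0⟩, rfl⟩)

/-- **Sard's theorem** for smooth maps from a finite-dimensional space to a Banach space, in the
form that the set of critical values is meagre. -/
theorem sardProperty (K : Type u) [NormedAddCommGroup K] [NormedSpace ℝ K]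
    [FiniteDimensional ℝ K] (Q : Type v) [NormedAddCommGroup Q] [NormedSpace ℝ Q]
    [CompleteSpace Q] : SardProperty K Q :=
  sardProperty_aux _ K Q rfl

end Sard

/-! ### The local Sard–Smale theorem for maps with a left quasi-inverse. -/

section Smale

variable {V : Type*} [NormedAddCommGroup V] [NormedSpace ℝ V] [CompleteSpace V]
  {W : Type*} [NormedAddCommGroup W] [NormedSpace ℝ W]
  {Y : Type*} [NormedAddCommGroup Y] [NormedSpace ℝ Y] [CompleteSpace Y]

omit [CompleteSpace V] [CompleteSpace Y] in
/-- A left quasi-inverse can be corrected to a partial inverse. -/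
theorem exists_partial_inverse (T : V →L[ℝ] Y) (R : Y →L[ℝ] V)
    (hR : FiniteDimensional ℝ (ContinuousLinearMap.id ℝ V - R.comp T).range) :
    ∃ S : Y →L[ℝ] V, (∀ y, S (T (S y)) = S y) ∧ FiniteDimensional ℝ (S.comp T).ker := by
  -- On `ker F`, which has finite codimension, `R ∘ T` is the identity. Projecting the values of `R`
  -- onto `ker F` gives `S`; then `ker (S ∘ T)` meets `ker F` trivially, so it embeds into the
  -- finite-dimensional range of `F`.
  set F := ContinuousLinearMap.id ℝ V - R.comp T with hF
  have hFx : ∀ x, F x = x - R (T x) := fun x => rfl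
  have hc : F.ker.ClosedComplemented := by
    have : FiniteDimensional ℝ (V ⧸ F.ker) :=
      (F.toLinearMap.quotKerEquivRange).symm.finiteDimensional
    exact Submodule.ClosedComplemented.of_finiteDimensional_quotient F.isClosed_ker
  obtain ⟨f, hf⟩ := hc
  set S : Y →L[ℝ] V := F.ker.subtypeL.comp (f.comp R) with hS
  have hSy : ∀ y, S y = f (R y) := fun y => rfl
  have hfix : ∀ z ∈ F.ker, S (T z) = z := by
    intro z hz
    have h1 : z - R (T z) = 0 := hz
    rw [hSy, ← sub_eq_zero.1 h1, hf ⟨z, hz⟩]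
  refine ⟨S, fun y => hfix _ (f (R y)).2, ?_⟩
  refine FiniteDimensional.of_injective
    (F.toLinearMap.rangeRestrict.comp (S.comp T).ker.subtype) ?_
  rw [← LinearMap.ker_eq_bot, LinearMap.ker_eq_bot']
  intro x hx
  have h1 : F (x : V) = 0 := congrArg Subtype.val hx
  have h2 : S (T (x : V)) = 0 := x.2
  exact Subtype.ext ((hfix _ h1).symm.trans h2)

/-- The local **Sard–Smale theorem** along the zero set of a submersion `h`: if the restriction
of the differential of `u` to the kernel of that of `h` has a left quasi-inverse, then
the critical values of `u` on the zero set of `h` are locally nowhere dense. -/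
theorem exists_nhds_isNowhereDense_of_leftQuasiInverse {h : V → W} {u : V → Y} {U : Set V}
    (hU : IsOpen U) (hh : ContDiffOn ℝ ∞ h U) (hu : ContDiffOn ℝ ∞ u U) {x₀ : V} (hx₀ : x₀ ∈ U)
    (h0 : h x₀ = 0) (hs : (fderiv ℝ h x₀).HasRightInverse) (R : Y →L[ℝ] V)
    (hR : FiniteDimensional ℝ ((ContinuousLinearMap.id ℝ V - R.comp (fderiv ℝ u x₀)).comp
      (fderiv ℝ h x₀).ker.subtypeL).range) :
    ∃ N ∈ 𝓝 x₀, IsNowhereDense (u '' {x ∈ N | h x = 0 ∧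
      ¬ ∀ y, ∃ v, fderiv ℝ h x v = 0 ∧ fderiv ℝ u x v = y}) := by
  obtain ⟨ψ, hψx, hψU, hψ1, hψ2, hψd, hψh⟩ := exists_straightening hU hh hx₀ hs
  obtain ⟨s, hs⟩ := hs
  set A := fderiv ℝ h x₀ with hA
  set T := fderiv ℝ u x₀ with hT
  set L := A.ker with hL
  have : CompleteSpace L := A.isClosed_ker.completeSpace_coe
  have huat : ∀ x ∈ U, HasFDerivAt u (fderiv ℝ u x) x := fun x hx =>
    ((hu.contDiffAt (hU.mem_nhds hx)).differentiableAt (by simp)).hasFDerivAt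
  have hhat : ∀ x ∈ U, HasFDerivAt h (fderiv ℝ h x) x := fun x hx =>
    ((hh.contDiffAt (hU.mem_nhds hx)).differentiableAt (by simp)).hasFDerivAt
  have hψat : ∀ v ∈ ψ.target, HasFDerivAt ψ.symm (fderiv ℝ ψ.symm v) v := fun v hv =>
    ((hψ2.contDiffAt (ψ.open_target.mem_nhds hv)).differentiableAt (by simp)).hasFDerivAt
  have hlx : ψ x₀ ∈ L := by
    change A (ψ x₀) = 0
    rw [hψh, h0]
  set l₀ : L := ⟨ψ x₀, hlx⟩ with hl₀
  set O : Set L := L.subtypeL ⁻¹' ψ.target with hO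
  have hOo : IsOpen O := ψ.open_target.preimage L.subtypeL.continuous
  set u₀ : L → Y := fun l => u (ψ.symm l) with hu₀
  have hu₀s : ContDiffOn ℝ ∞ u₀ O :=
    hu.comp (hψ2.comp L.subtypeL.contDiff.contDiffOn fun l hl => hl)
      fun l hl => hψU (ψ.map_target hl)
  have hu₀d : ∀ l ∈ O, fderiv ℝ u₀ l =
      ((fderiv ℝ u (ψ.symm l)).comp (fderiv ℝ ψ.symm l)).comp L.subtypeL := by
    intro l hl
    have h1 := (huat _ (hψU (ψ.map_target hl))).comp (l : V) (hψat _ hl)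
    exact (h1.comp l L.subtypeL.hasFDerivAt).fderiv
  have hl₀O : l₀ ∈ O := ψ.map_source hψx
  -- The straightening is tangent to the identity at `x₀`, so the differential of `u₀` at `l₀` is
  -- exactly `T` restricted to `L`; composing `R` with the projection `e` onto `L` then gives a left
  -- quasi-inverse for it.
  have hinv : fderiv ℝ ψ.symm (ψ x₀) = ContinuousLinearMap.id ℝ V := by
    have h1 : HasFDerivAt ψ (ContinuousLinearMap.id ℝ V) (ψ.symm (ψ x₀)) := by
      rw [ψ.left_inv hψx, ← hψd]
      exact ((hψ1.contDiffAt (ψ.open_source.mem_nhds hψx)).differentiableAt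
        (by simp)).hasFDerivAt
    have h2 := h1.comp (ψ x₀) (hψat _ hl₀O)
    have h3 : (fun v => ψ (ψ.symm v)) =ᶠ[𝓝 (ψ x₀)] id := by
      filter_upwards [ψ.open_target.mem_nhds hl₀O] with v hv using ψ.right_inv hv
    exact h2.unique ((hasFDerivAt_id _).congr_of_eventuallyEq h3)
  have hT₀ : fderiv ℝ u₀ l₀ = T.comp L.subtypeL := by
    rw [hu₀d l₀ hl₀O]
    simp only [hl₀, hinv, ψ.left_inv hψx, ContinuousLinearMap.comp_id, ← hT]
  set e : V →L[ℝ] L := (ContinuousLinearMap.id ℝ V - s.comp A).codRestrict L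
    (fun v => by simp [hL, hs (A v)]) with he
  have hel : ∀ l : L, e l = l := by
    intro l
    have h1 : A (l : V) = 0 := l.2
    apply Subtype.ext
    simp [he, h1]
  obtain ⟨S, hS1, hS2⟩ := exists_partial_inverse (fderiv ℝ u₀ l₀) (e.comp R) (by
    have h1 : ContinuousLinearMap.id ℝ L - (e.comp R).comp (fderiv ℝ u₀ l₀) =
        e.comp ((ContinuousLinearMap.id ℝ V - R.comp T).comp L.subtypeL) := by
      rw [hT₀]
      ext l
      simp [hel]
    have h2 : (ContinuousLinearMap.id ℝ L - (e.comp R).comp (fderiv ℝ u₀ l₀)).range =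
        ((ContinuousLinearMap.id ℝ V - R.comp T).comp L.subtypeL).range.map e.toLinearMap := by
      rw [h1]
      exact LinearMap.range_comp _ _
    rw [h2]
    infer_instance)
  have : CompleteSpace S.ker := S.isClosed_ker.completeSpace_coe
  obtain ⟨N₀, hN₀, hN₀'⟩ := exists_nhds_isNowhereDense_of_sardProperty hOo hu₀s hl₀O S hS1 hS2
    (sardProperty _ _)
  obtain ⟨O', hO', hO'N⟩ := mem_nhds_induced _ _ _ |>.1 hN₀
  refine ⟨ψ.source ∩ ψ ⁻¹' O', Filter.inter_mem (ψ.open_source.mem_nhds hψx)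
    ((ψ.continuousAt hψx).preimage_mem_nhds hO'), hN₀'.mono ?_⟩
  rintro _ ⟨x, ⟨⟨hx1, hx2⟩, hx3, hx4⟩, rfl⟩
  have hxL : ψ x ∈ L := by
    change A (ψ x) = 0
    rw [hψh, hx3]
  have hxt := ψ.map_source hx1
  refine ⟨⟨ψ x, hxL⟩, ⟨hO'N hx2, fun hsurj => hx4 fun y => ?_⟩, by simp [hu₀, ψ.left_inv hx1]⟩
  obtain ⟨l, hl⟩ := hsurj y
  rw [hu₀d _ hxt] at hl
  refine ⟨fderiv ℝ ψ.symm (ψ x) l, ?_, ?_⟩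
  · have h1 : HasFDerivAt h (fderiv ℝ h x) (ψ.symm (ψ x)) := by
      rw [ψ.left_inv hx1]; exact hhat x (hψU hx1)
    have h2 := h1.comp (ψ x) (hψat _ hxt)
    have h3 : (h ∘ ψ.symm) =ᶠ[𝓝 (ψ x)] A := by
      filter_upwards [ψ.open_target.mem_nhds hxt] with v hv
      rw [Function.comp_apply, ← hψh, ψ.right_inv hv]
    have h4 := h2.unique (A.hasFDerivAt.congr_of_eventuallyEq h3)
    exact (congrArg (fun f : V →L[ℝ] W => f l) h4).trans l.2
  · simpa [ψ.left_inv hx1] using hl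

end Smale

/-! ### Tangent spaces and differentials along submanifolds. -/

section Tangent

variable {E : Type*} [NormedAddCommGroup E] [NormedSpace ℝ E]
  {H : Type*} [TopologicalSpace H] (I : ModelWithCorners ℝ E H)
  {X : Type*} [TopologicalSpace X] [ChartedSpace H X]
  {E' : Type*} [NormedAddCommGroup E'] [NormedSpace ℝ E']
  {H' : Type*} [TopologicalSpace H'] (I' : ModelWithCorners ℝ E' H')
  {Y : Type*} [TopologicalSpace Y] [ChartedSpace H' Y]
  {E'' : Type*} [NormedAddCommGroup E''] [NormedSpace ℝ E'']
  {H'' : Type*} [TopologicalSpace H''] (I'' : ModelWithCorners ℝ E'' H'')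
  {Z : Type*} [TopologicalSpace Z] [ChartedSpace H'' Z]

/-- The differential `mfderiv` as a map between the model spaces. -/
noncomputable def mD (f : X → Y) (x : X) : E →L[ℝ] E' := mfderiv I I' f x

/-- The differential `mfderivWithin` as a map between the model spaces. -/
noncomputable def mDW (f : X → Y) (S : Set X) (x : X) : E →L[ℝ] E' := mfderivWithin I I' f S x

/-- `tangentSubspace` as a subspace of the model space. -/
noncomputable def tS (S : Set X) (x : X) : Submodule ℝ E := tangentSubspace I S x

theorem mD_comp {g : Y → Z} {f : X → Y} {x : X} (hg : MDifferentiableAt I' I'' g (f x))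
    (hf : MDifferentiableAt I I' f x) :
    mD I I'' (fun y => g (f y)) x = (mD I' I'' g (f x)).comp (mD I I' f x) :=
  mfderiv_comp x hg hf

theorem mD_congr {f g : X → Y} {x : X} (h : f =ᶠ[𝓝 x] g) : mD I I' f x = mD I I' g x := by
  have := h.mfderiv_eq (I := I) (I' := I')
  exact this

theorem mD_eq_fderiv (f : E → E') (x : E) : mD 𝓘(ℝ, E) 𝓘(ℝ, E') f x = fderiv ℝ f x :=
  mfderiv_eq_fderiv

theorem mD_snd (x : X × Y) : mD (I.prod I') I' Prod.snd x = ContinuousLinearMap.snd ℝ E E' :=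
  mfderiv_snd

theorem mD_prodMk_left (x : X) (y : Y) :
    mD I (I.prod I') (fun x => (x, y)) x = ContinuousLinearMap.inl ℝ E E' :=
  mfderiv_prod_left

theorem mD_id (x : X) : mD I I id x = ContinuousLinearMap.id ℝ E := mfderiv_id

variable {I I'} in
theorem BanachSubmanifold.IsSmoothChart.mdifferentiableAt {φ : OpenPartialHomeomorph X E}
    (hφ : IsSmoothChart I φ) {x : X} (hx : x ∈ φ.source) : MDifferentiableAt I 𝓘(ℝ, E) φ x :=
  (hφ.1.contMDiffAt (φ.open_source.mem_nhds hx)).mdifferentiableAt (by simp)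

variable {I I'} in
theorem BanachSubmanifold.IsSmoothChart.mdifferentiableAt_symm {φ : OpenPartialHomeomorph X E}
    (hφ : IsSmoothChart I φ) {v : E} (hv : v ∈ φ.target) :
    MDifferentiableAt 𝓘(ℝ, E) I φ.symm v :=
  (hφ.2.contMDiffAt (φ.open_target.mem_nhds hv)).mdifferentiableAt (by simp)

variable {I I'} in
theorem BanachSubmanifold.IsSmoothChart.mD_symm_mD {φ : OpenPartialHomeomorph X E}
    (hφ : IsSmoothChart I φ) {x : X} (hx : x ∈ φ.source) (v : E) :
    mD 𝓘(ℝ, E) I φ.symm (φ x) (mD I 𝓘(ℝ, E) φ x v) = v := by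
  have h1 := mD_comp I 𝓘(ℝ, E) I (hφ.mdifferentiableAt_symm (φ.map_source hx))
    (hφ.mdifferentiableAt hx)
  have h2 : mD I I (fun y => φ.symm (φ y)) x = mD I I id x := mD_congr I I (by
    filter_upwards [φ.open_source.mem_nhds hx] with y hy using φ.left_inv hy)
  rw [mD_id, h1] at h2
  exact congrArg (fun f : E →L[ℝ] E => f v) h2

variable {I I'} in
theorem BanachSubmanifold.IsSmoothChart.mD_mD_symm {φ : OpenPartialHomeomorph X E}
    (hφ : IsSmoothChart I φ) {x : X} (hx : x ∈ φ.source) (v : E) :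
    mD I 𝓘(ℝ, E) φ x (mD 𝓘(ℝ, E) I φ.symm (φ x) v) = v := by
  have hxt := φ.map_source hx
  have h1 := mD_comp 𝓘(ℝ, E) I 𝓘(ℝ, E) (f := φ.symm) (g := φ) (x := φ x)
    (by rw [φ.left_inv hx]; exact hφ.mdifferentiableAt hx) (hφ.mdifferentiableAt_symm hxt)
  have h2 : mD 𝓘(ℝ, E) 𝓘(ℝ, E) (fun y => φ (φ.symm y)) (φ x) = mD 𝓘(ℝ, E) 𝓘(ℝ, E) id (φ x) :=
    mD_congr _ _ (by
      filter_upwards [φ.open_target.mem_nhds hxt] with y hy using φ.right_inv hy)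
  rw [mD_id, h1, φ.left_inv hx] at h2
  exact congrArg (fun f : E →L[ℝ] E => f v) h2

/-- The velocities of smooth curves in `S` through `x`. -/
theorem tS_le_iff {S : Set X} {x : X} {L : Submodule ℝ E} :
    tS I S x ≤ L ↔ ∀ γ : ℝ → X, γ 0 = x → ∀ U ∈ 𝓝 (0 : ℝ), ContMDiffOn 𝓘(ℝ, ℝ) I ∞ γ U →
      Set.MapsTo γ U S → mD 𝓘(ℝ, ℝ) I γ 0 1 ∈ L := by
  refine Submodule.span_le.trans ⟨fun h γ h0 U hU hγ hS => h ⟨γ, h0, ⟨U, hU, hγ, hS⟩, rfl⟩, ?_⟩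
  rintro h v ⟨γ, h0, ⟨U, hU, hγ, hS⟩, rfl⟩
  exact h γ h0 U hU hγ hS

theorem mem_tS_of_curve {S : Set X} {x : X} {γ : ℝ → X} (h0 : γ 0 = x) {U : Set ℝ}
    (hU : U ∈ 𝓝 (0 : ℝ)) (hγ : ContMDiffOn 𝓘(ℝ, ℝ) I ∞ γ U) (hS : Set.MapsTo γ U S) :
    mD 𝓘(ℝ, ℝ) I γ 0 1 ∈ tS I S x :=
  tS_le_iff I |>.1 le_rfl γ h0 U hU hγ hS

/-- A complemented subspace is the kernel of a split surjection. -/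
theorem Submodule.ClosedComplemented.exists_eq_ker [CompleteSpace E] {L : Submodule ℝ E}
    (hL : L.ClosedComplemented) :
    ∃ (W : Submodule ℝ E) (q : E →L[ℝ] W), CompleteSpace W ∧ q.HasRightInverse ∧
      ∀ v, v ∈ L ↔ q v = 0 := by
  obtain ⟨f, hf⟩ := hL
  set q : E →L[ℝ] f.ker := (ContinuousLinearMap.id ℝ E - L.subtypeL.comp f).codRestrict f.ker
    (fun v => by simp [hf]) with hq
  have hqv : ∀ v, (q v : E) = v - f v := fun v => rfl
  refine ⟨f.ker, q, f.isClosed_ker.completeSpace_coe, ⟨f.ker.subtypeL, fun w => ?_⟩, fun v => ?_⟩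
  · apply Subtype.ext
    have : f (w : E) = 0 := w.2
    rw [hqv]
    simp [this]
  · constructor
    · intro hv
      apply Subtype.ext
      rw [hqv, hf ⟨v, hv⟩]
      simp
    · intro hv
      have h1 : v - f v = 0 := by rw [← hqv, hv]; rfl
      rw [sub_eq_zero.1 h1]
      exact (f v).2

-- Write `L` as the kernel of `q`: a curve `γ` in `S` has `q ∘ φ ∘ γ = 0`, and differentiating gives
-- one inclusion. For the other, the straight line through `φ x` in a direction of `L` pulls back to
-- a curve in `S`.
variable {I} in
theorem mem_tS_iff_of_isSlice [CompleteSpace E] {φ : OpenPartialHomeomorph X E}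
    (hφ : IsSmoothChart I φ) {S : Set X} {L : Submodule ℝ E} (hL : L.ClosedComplemented)
    (hS : IsSlice φ S L) {x : X} (hx : x ∈ φ.source) (hxS : x ∈ S) (v : E) :
    v ∈ tS I S x ↔ mD I 𝓘(ℝ, E) φ x v ∈ L := by
  constructor
  · obtain ⟨W, q, -, -, hq⟩ := hL.exists_eq_ker
    suffices h : tS I S x ≤ L.comap (mD I 𝓘(ℝ, E) φ x).toLinearMap from fun hv => h hv
    rw [tS_le_iff]
    rintro γ rfl U hU hγ hγS
    change mD I 𝓘(ℝ, E) φ (γ 0) (mD 𝓘(ℝ, ℝ) I γ 0 1) ∈ L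
    have hγd : MDifferentiableAt 𝓘(ℝ, ℝ) I γ 0 := (hγ.contMDiffAt hU).mdifferentiableAt (by simp)
    have hφd := hφ.mdifferentiableAt hx
    have h1 := mD_comp 𝓘(ℝ, ℝ) I 𝓘(ℝ, E) hφd hγd
    have h2 := mD_comp 𝓘(ℝ, ℝ) 𝓘(ℝ, E) 𝓘(ℝ, W) (g := q) (f := fun t => φ (γ t)) (x := 0)
      (q.differentiableAt.mdifferentiableAt) (hφd.comp 0 hγd)
    have h3 : mD 𝓘(ℝ, ℝ) 𝓘(ℝ, W) (fun t => q (φ (γ t))) (0 : ℝ) =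
        mD 𝓘(ℝ, ℝ) 𝓘(ℝ, W) (fun _ => (0 : W)) (0 : ℝ) := by
      refine mD_congr _ _ ?_
      filter_upwards [hU, hγd.continuousAt.preimage_mem_nhds (φ.open_source.mem_nhds hx)]
        with t ht ht'
      exact (hq _).1 ((hS _ ht').1 (hγS ht))
    rw [h2, h1, mD_eq_fderiv, mD_eq_fderiv, fderiv_fun_const, q.fderiv] at h3
    rw [hq]
    exact congrArg (fun f : ℝ →L[ℝ] W => f 1) h3
  · intro hv
    set w := mD I 𝓘(ℝ, E) φ x v with hw
    have hφx : φ x ∈ L := (hS x hx).1 hxS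
    set line : ℝ → E := fun t => φ x + t • w with hline
    have hl0 : line 0 = φ x := by simp [hline]
    have hls : ContDiff ℝ ∞ line := contDiff_const.add (contDiff_id.smul contDiff_const)
    have hopen : IsOpen (line ⁻¹' φ.target) := φ.open_target.preimage hls.continuous
    have hU : line ⁻¹' φ.target ∈ 𝓝 (0 : ℝ) :=
      hopen.mem_nhds (by rw [Set.mem_preimage, hl0]; exact φ.map_source hx)
    have hd := mem_tS_of_curve I (S := S) (x := x) (γ := fun t => φ.symm (line t))
      (by rw [hl0, φ.left_inv hx]) hU
      (hφ.2.comp hls.contMDiff.contMDiffOn fun t ht => ht)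
      (fun t ht => (hS _ (φ.map_target ht)).2 (by
        rw [φ.right_inv ht]; exact L.add_mem hφx (L.smul_mem t hv)))
    have h1 := mD_comp 𝓘(ℝ, ℝ) 𝓘(ℝ, E) I (g := φ.symm) (f := line) (x := 0)
      (by rw [hl0]; exact hφ.mdifferentiableAt_symm (φ.map_source hx))
      ((hls.differentiable (by simp)) 0).mdifferentiableAt
    have h2 : fderiv ℝ line 0 1 = w := by
      have : HasDerivAt line ((1 : ℝ) • w) 0 := ((hasDerivAt_id (0 : ℝ)).smul_const w).const_add _
      rw [fderiv_apply_one_eq_deriv, this.deriv, one_smul]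
    rw [h1, ContinuousLinearMap.comp_apply, mD_eq_fderiv, h2, hl0, hw, hφ.mD_symm_mD hx] at hd
    exact hd

/-- The differential along `S` is computed by any differentiable extension. -/
theorem mDW_eq_mD_of_mem_tS {S : Set X} {f g : X → Y} {x : X}
    (hf : MDifferentiableWithinAt I I' f S x) (hg : MDifferentiableAt I I' g x)
    (hfg : ∀ᶠ y in 𝓝 x, y ∈ S → g y = f y) {v : E} (hv : v ∈ tS I S x) :
    mDW I I' f S x v = mD I I' g x v := by
  suffices h : tS I S x ≤ LinearMap.eqLocus
      (mDW I I' f S x).toLinearMap (mD I I' g x).toLinearMap from h hv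
  rw [tS_le_iff]
  rintro γ rfl U hU hγ hγS
  have hγd : MDifferentiableAt 𝓘(ℝ, ℝ) I γ 0 := (hγ.contMDiffAt hU).mdifferentiableAt (by simp)
  -- Derivatives within `S` need not be unique, but the chain rule along a curve inside `S` fixes
  -- their value on its velocity.
  have h1 : HasMFDerivAt 𝓘(ℝ, ℝ) I' (fun t => f (γ t)) 0
      ((mfderivWithin I I' f S (γ 0)).comp (mfderiv 𝓘(ℝ, ℝ) I γ 0)) :=
    (hf.hasMFDerivWithinAt.comp 0 hγd.hasMFDerivAt.hasMFDerivWithinAt hγS).hasMFDerivAt hU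
  have h2 : mD 𝓘(ℝ, ℝ) I' (fun t => g (γ t)) 0 = (mD I I' g (γ 0)).comp (mD 𝓘(ℝ, ℝ) I γ 0) :=
    mD_comp _ _ _ hg hγd
  have h3 : mD 𝓘(ℝ, ℝ) I' (fun t => g (γ t)) 0 = mD 𝓘(ℝ, ℝ) I' (fun t => f (γ t)) 0 := by
    refine mD_congr _ _ ?_
    filter_upwards [hU, hγd.continuousAt.eventually hfg] with t ht ht'
    exact ht' (hγS ht)
  have h4 : mD 𝓘(ℝ, ℝ) I' (fun t => f (γ t)) 0 =
      (mDW I I' f S (γ 0)).comp (mD 𝓘(ℝ, ℝ) I γ 0) := h1.mfderiv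
  rw [h2, h4] at h3
  exact (congrArg (fun f : ℝ →L[ℝ] E' => f 1) h3).symm

end Tangent

/-! ### Submanifolds as zero sets of submersions, and Sard–Smale on manifolds. -/

section Defining

/-- A closed complement of the kernel maps bijectively onto `W`, and the inverse is continuous by
the open mapping theorem. -/
theorem ContinuousLinearMap.hasRightInverse_of_closedComplemented_ker {V W : Type*}
    [NormedAddCommGroup V] [NormedSpace ℝ V] [CompleteSpace V]
    [NormedAddCommGroup W] [NormedSpace ℝ W] [CompleteSpace W] {b : V →L[ℝ] W}
    (hb : Function.Surjective b) (hk : b.ker.ClosedComplemented) : b.HasRightInverse := by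
  obtain ⟨f, hf⟩ := hk
  have : CompleteSpace f.ker := f.isClosed_ker.completeSpace_coe
  set b' : f.ker →L[ℝ] W := b.comp f.ker.subtypeL with hb'
  have hinj : b'.ker = ⊥ := by
    rw [LinearMap.ker_eq_bot']
    intro n hn
    have h1 : b (n : V) = 0 := hn
    have h2 : f (n : V) = 0 := n.2
    rw [hf ⟨n, h1⟩] at h2
    exact Subtype.ext (congrArg (Subtype.val : b.ker → V) h2)
  have hsurj : b'.range = ⊤ := by
    rw [LinearMap.range_eq_top]
    intro w
    obtain ⟨v, rfl⟩ := hb w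
    refine ⟨⟨v - f v, by simp [hf]⟩, ?_⟩
    change b (v - f v) = b v
    have h1 : b (f v : V) = 0 := (f v).2
    rw [map_sub, h1, sub_zero]
  set e := ContinuousLinearEquiv.ofBijective b' hinj hsurj with he
  refine ⟨f.ker.subtypeL.comp (e.symm : W →L[ℝ] f.ker), fun w => ?_⟩
  exact ContinuousLinearEquiv.ofBijective_apply_symm_apply b' hinj hsurj w

/-- Solve for the first component by `s₁`, then correct the second by a vector of `ker a`, which
leaves the first unchanged. -/
theorem ContinuousLinearMap.HasRightInverse.prod {V W₁ W₂ : Type*}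
    [NormedAddCommGroup V] [NormedSpace ℝ V] [CompleteSpace V]
    [NormedAddCommGroup W₁] [NormedSpace ℝ W₁]
    [NormedAddCommGroup W₂] [NormedSpace ℝ W₂] [CompleteSpace W₂] {a : V →L[ℝ] W₁}
    {b : V →L[ℝ] W₂} (ha : a.HasRightInverse)
    (hb : (b.comp a.ker.subtypeL).HasRightInverse) : (a.prod b).HasRightInverse := by
  obtain ⟨s₁, h₁⟩ := ha
  obtain ⟨s₂, h₂⟩ := hb
  refine ⟨s₁.comp (ContinuousLinearMap.fst ℝ W₁ W₂) + a.ker.subtypeL.comp (s₂.comp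
    (ContinuousLinearMap.snd ℝ W₁ W₂ -
      (b.comp s₁).comp (ContinuousLinearMap.fst ℝ W₁ W₂))), fun w => ?_⟩
  have h₂' := h₂ (w.2 - b (s₁ w.1))
  simp only [ContinuousLinearMap.comp_apply, Submodule.subtypeL_apply] at h₂'
  refine Prod.ext ?_ ?_
  · simp [h₁ w.1]
  · change b (s₁ w.1 + (s₂ (w.2 - b (s₁ w.1)) : V)) = w.2
    rw [map_add, h₂', add_sub_cancel]

theorem OpenPartialHomeomorph.isNowhereDense_of_image {A B : Type*} [TopologicalSpace A]
    [TopologicalSpace B] (χ : OpenPartialHomeomorph A B) {s : Set A} (hs : s ⊆ χ.source)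
    (h : IsNowhereDense (χ '' s)) : IsNowhereDense s := by
  rw [IsNowhereDense, Set.eq_empty_iff_forall_notMem] at h ⊢
  intro y hy
  obtain ⟨b, hbG, hbs⟩ := mem_closure_iff.1 (interior_subset hy) _ isOpen_interior hy
  have hopen : IsOpen (χ '' (interior (closure s) ∩ χ.source)) :=
    χ.isOpen_image_of_subset_source (isOpen_interior.inter χ.open_source) Set.inter_subset_right
  refine h (χ b) (interior_maximal ?_ hopen ⟨b, ⟨hbG, hs hbs⟩, rfl⟩)
  rintro _ ⟨z, ⟨hz1, hz2⟩, rfl⟩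
  exact mem_closure_image (χ.continuousAt hz2) (interior_subset hz1)

variable {E : Type*} [NormedAddCommGroup E] [NormedSpace ℝ E]
  {H : Type*} [TopologicalSpace H] (I : ModelWithCorners ℝ E H)
  {X : Type*} [TopologicalSpace X] [ChartedSpace H X]
  {E' : Type*} [NormedAddCommGroup E'] [NormedSpace ℝ E']
  {H' : Type*} [TopologicalSpace H'] (I' : ModelWithCorners ℝ E' H')
  {Y : Type*} [TopologicalSpace Y] [ChartedSpace H' Y]
  {W : Type*} [NormedAddCommGroup W] [NormedSpace ℝ W]

variable {I I'} in
/-- A smooth map on a submanifold extends locally to a smooth map on a neighborhood. -/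
theorem exists_local_extension {φ : OpenPartialHomeomorph X E} (hφ : IsSmoothChart I φ)
    {S : Set X} {L : Submodule ℝ E} (hL : L.ClosedComplemented) (hS : IsSlice φ S L) {x : X}
    (hx : x ∈ φ.source) (hxS : x ∈ S) {f : X → Y} (hf : ContMDiffOn I I' ∞ f S) :
    ∃ (U : Set X) (g : X → Y), IsOpen U ∧ x ∈ U ∧ ContMDiffOn I I' ∞ g U ∧
      ∀ y ∈ U, y ∈ S → g y = f y := by
  obtain ⟨r, hr⟩ := hL
  -- The extension precomposes `f` with the projection onto `L` in the chart, which fixes the points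
  -- of `S`.
  set p : E →L[ℝ] E := L.subtypeL.comp r with hp
  have hpL : ∀ v, p v ∈ L := fun v => (r v).2
  have hpp : ∀ v ∈ L, p v = v := fun v hv => congrArg Subtype.val (hr ⟨v, hv⟩)
  have hopen : IsOpen (φ.source ∩ φ ⁻¹' (p ⁻¹' φ.target)) :=
    φ.isOpen_inter_preimage (φ.open_target.preimage p.continuous)
  refine ⟨_, fun y => f (φ.symm (p (φ y))), hopen, ⟨hx, ?_⟩, ?_, ?_⟩
  · rw [Set.mem_preimage, Set.mem_preimage, hpp _ ((hS x hx).1 hxS)]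
    exact φ.map_source hx
  · have h1 : ContMDiffOn I 𝓘(ℝ, E) ∞ (fun y => p (φ y)) (φ.source ∩ φ ⁻¹' (p ⁻¹' φ.target)) :=
      p.contDiff.contMDiff.comp_contMDiffOn (hφ.1.mono Set.inter_subset_left)
    refine hf.comp (hφ.2.comp h1 fun y hy => hy.2) fun y hy => ?_
    refine (hS _ (φ.map_target hy.2)).2 ?_
    rw [φ.right_inv hy.2]
    exact hpL _
  · intro y hy hyS
    change f (φ.symm (p (φ y))) = f y
    rw [hpp _ ((hS y hy.1).1 hyS), φ.left_inv hy.1]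

/-- The set `S` is the zero set of the submersion `g` on the open set `U`. -/
structure IsDefiningOn (S : Set X) (g : X → W) (U : Set X) : Prop where
  isOpen : IsOpen U
  contMDiffOn : ContMDiffOn I 𝓘(ℝ, W) ∞ g U
  mem_iff : ∀ y ∈ U, (y ∈ S ↔ g y = 0)
  hasRightInverse : ∀ y ∈ U, (mD I 𝓘(ℝ, W) g y).HasRightInverse
  mem_tS_iff : ∀ y ∈ U, y ∈ S → ∀ v, v ∈ tS I S y ↔ mD I 𝓘(ℝ, W) g y v = 0

variable {I} in
theorem IsDefiningOn.mdifferentiableAt {S : Set X} {g : X → W} {U : Set X}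
    (h : IsDefiningOn I S g U) {y : X} (hy : y ∈ U) : MDifferentiableAt I 𝓘(ℝ, W) g y :=
  (h.contMDiffOn.contMDiffAt (h.isOpen.mem_nhds hy)).mdifferentiableAt (by simp)

-- The defining map is `q ∘ φ`, with `q` a split surjection whose kernel is `L`; it is a submersion
-- on the whole chart domain, not only along `S`.
variable {I} in
theorem exists_isDefiningOn_of_isSlice [CompleteSpace E] {φ : OpenPartialHomeomorph X E}
    (hφ : IsSmoothChart I φ) {S : Set X} {L : Submodule ℝ E} (hL : L.ClosedComplemented)
    (hS : IsSlice φ S L) :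
    ∃ (W : Submodule ℝ E) (g : X → W), CompleteSpace W ∧ IsDefiningOn I S g φ.source := by
  obtain ⟨W, q, hW, hq, hqL⟩ := hL.exists_eq_ker
  have hd : ∀ y ∈ φ.source, mD I 𝓘(ℝ, W) (fun y => q (φ y)) y = q.comp (mD I 𝓘(ℝ, E) φ y) := by
    intro y hy
    rw [mD_comp I 𝓘(ℝ, E) 𝓘(ℝ, W) q.differentiableAt.mdifferentiableAt (hφ.mdifferentiableAt hy),
      mD_eq_fderiv, q.fderiv]
  refine ⟨W, fun y => q (φ y), hW, φ.open_source, q.contDiff.contMDiff.comp_contMDiffOn hφ.1,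
    fun y hy => (hS y hy).trans (hqL _), fun y hy => ?_, fun y hy hyS v => ?_⟩
  · rw [hd y hy]
    exact hq.comp ⟨_, hφ.mD_mD_symm hy⟩
  · rw [hd y hy, mem_tS_iff_of_isSlice hφ hL hS hy hyS, hqL]
    rfl

variable {I} in
/-- In a suitable smooth chart of `X`, a map with split surjective differential is linear. -/
theorem exists_isSmoothChart_linear {X : Type*} [TopologicalSpace X] [ChartedSpace E X]
    [IsManifold 𝓘(ℝ, E) ∞ X] [CompleteSpace E] {g : X → W} {U : Set X} (hU : IsOpen U)
    (hg : ContMDiffOn 𝓘(ℝ, E) 𝓘(ℝ, W) ∞ g U) {x : X} (hx : x ∈ U)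
    (hs : (mD 𝓘(ℝ, E) 𝓘(ℝ, W) g x).HasRightInverse) :
    ∃ (φ : OpenPartialHomeomorph X E) (A : E →L[ℝ] W), IsSmoothChart 𝓘(ℝ, E) φ ∧ x ∈ φ.source ∧
      φ.source ⊆ U ∧ A.HasRightInverse ∧ ∀ y ∈ φ.source, g y = A (φ y) := by
  set a : OpenPartialHomeomorph X E := chartAt E x with ha
  have hac : IsSmoothChart 𝓘(ℝ, E) a := ⟨contMDiffOn_chart, contMDiffOn_chart_symm⟩
  have hxa : x ∈ a.source := mem_chart_source E x
  set O : Set E := a.target ∩ a.symm ⁻¹' U with hO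
  have hOo : IsOpen O := a.isOpen_inter_preimage_symm hU
  have hgO : ContDiffOn ℝ ∞ (fun v => g (a.symm v)) O :=
    contMDiffOn_iff_contDiffOn.1
      (hg.comp (hac.2.mono Set.inter_subset_left) fun v hv => hv.2)
  have hxO : a x ∈ O := ⟨a.map_source hxa, by rwa [Set.mem_preimage, a.left_inv hxa]⟩
  have hd : fderiv ℝ (fun v => g (a.symm v)) (a x) =
      (mD 𝓘(ℝ, E) 𝓘(ℝ, W) g x).comp (mD 𝓘(ℝ, E) 𝓘(ℝ, E) a.symm (a x)) := by
    rw [← mD_eq_fderiv, mD_comp 𝓘(ℝ, E) 𝓘(ℝ, E) 𝓘(ℝ, W) (g := g) (f := a.symm) (x := a x) ?_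
      (hac.mdifferentiableAt_symm (a.map_source hxa)), a.left_inv hxa]
    rw [a.left_inv hxa]
    exact (hg.contMDiffAt (hU.mem_nhds hx)).mdifferentiableAt (by simp)
  have hr : (fderiv ℝ (fun v => g (a.symm v)) (a x)).HasRightInverse := by
    rw [hd]
    exact hs.comp ⟨_, hac.mD_symm_mD hxa⟩
  obtain ⟨ψ, hψx, hψO, hψ1, hψ2, -, hψg⟩ := exists_straightening hOo hgO hxO hr
  refine ⟨a.trans ψ, _, ⟨?_, ?_⟩, ?_, ?_, hr, ?_⟩
  · rw [OpenPartialHomeomorph.trans_source]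
    exact hψ1.contMDiffOn.comp (hac.1.mono Set.inter_subset_left) fun y hy => hy.2
  · rw [OpenPartialHomeomorph.trans_target]
    exact hac.2.comp (hψ2.contMDiffOn.mono Set.inter_subset_left) fun y hy => hy.2
  · rw [OpenPartialHomeomorph.trans_source]
    exact ⟨hxa, hψx⟩
  · rw [OpenPartialHomeomorph.trans_source]
    intro y hy
    have := (hψO hy.2).2
    rwa [Set.mem_preimage, a.left_inv hy.1] at this
  · rw [OpenPartialHomeomorph.trans_source]
    intro y hy
    rw [OpenPartialHomeomorph.coe_trans, Function.comp_apply, hψg, a.left_inv hy.1]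

variable {I} in
/-- The local **Sard–Smale theorem** on manifolds, along the zero set of a submersion `h`. -/
theorem exists_nhds_isNowhereDense_image {EP : Type*} [NormedAddCommGroup EP] [NormedSpace ℝ EP]
    [CompleteSpace EP] {P : Type*} [TopologicalSpace P] [ChartedSpace EP P]
    [IsManifold 𝓘(ℝ, EP) ∞ P] [CompleteSpace E] {φ : OpenPartialHomeomorph X E}
    (hφ : IsSmoothChart I φ) {π : X → P} (hπ : ContMDiff I 𝓘(ℝ, EP) ∞ π) {h : X → W} {U : Set X}
    (hU : IsOpen U) (hh : ContMDiffOn I 𝓘(ℝ, W) ∞ h U) {x₀ : X} (hx₀ : x₀ ∈ U)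
    (hx₀φ : x₀ ∈ φ.source) (h0 : h x₀ = 0) (hs : (mD I 𝓘(ℝ, W) h x₀).HasRightInverse)
    (R : EP →L[ℝ] E) (D : Submodule ℝ E) [FiniteDimensional ℝ D]
    (hR : ∀ v, mD I 𝓘(ℝ, W) h x₀ v = 0 → v - R (mD I 𝓘(ℝ, EP) π x₀ v) ∈ D) :
    ∃ N ∈ 𝓝 x₀, IsNowhereDense (π '' {x ∈ N | h x = 0 ∧
      ¬ ∀ y, ∃ v, mD I 𝓘(ℝ, W) h x v = 0 ∧ mD I 𝓘(ℝ, EP) π x v = y}) := by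
  set χ : OpenPartialHomeomorph P EP := chartAt EP (π x₀) with hχdef
  have hχ : IsSmoothChart 𝓘(ℝ, EP) χ := ⟨contMDiffOn_chart, contMDiffOn_chart_symm⟩
  have hxχ : π x₀ ∈ χ.source := mem_chart_source EP (π x₀)
  set U' : Set X := U ∩ π ⁻¹' χ.source with hU'
  have hU'o : IsOpen U' := hU.inter (χ.open_source.preimage hπ.continuous)
  set O : Set E := φ.target ∩ φ.symm ⁻¹' U' with hO
  have hOo : IsOpen O := φ.isOpen_inter_preimage_symm hU'o
  have hx₀O : φ x₀ ∈ O :=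
    ⟨φ.map_source hx₀φ, by rw [Set.mem_preimage, φ.left_inv hx₀φ]; exact ⟨hx₀, hxχ⟩⟩
  have hhO : ContDiffOn ℝ ∞ (fun v => h (φ.symm v)) O :=
    contMDiffOn_iff_contDiffOn.1
      (hh.comp (hφ.2.mono Set.inter_subset_left) fun v hv => hv.2.1)
  have huO : ContDiffOn ℝ ∞ (fun v => χ (π (φ.symm v))) O :=
    contMDiffOn_iff_contDiffOn.1 (hχ.1.comp
      (hπ.comp_contMDiffOn (hφ.2.mono Set.inter_subset_left)) fun v hv => hv.2.2)
  have hhd : ∀ x ∈ φ.source, x ∈ U' → fderiv ℝ (fun v => h (φ.symm v)) (φ x) =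
      (mD I 𝓘(ℝ, W) h x).comp (mD 𝓘(ℝ, E) I φ.symm (φ x)) := by
    intro x hx hxU
    rw [← mD_eq_fderiv, mD_comp 𝓘(ℝ, E) I 𝓘(ℝ, W) (g := h) (f := φ.symm) (x := φ x) ?_
      (hφ.mdifferentiableAt_symm (φ.map_source hx)), φ.left_inv hx]
    rw [φ.left_inv hx]
    exact (hh.contMDiffAt (hU.mem_nhds hxU.1)).mdifferentiableAt (by simp)
  have hud : ∀ x ∈ φ.source, x ∈ U' → fderiv ℝ (fun v => χ (π (φ.symm v))) (φ x) =
      (mD 𝓘(ℝ, EP) 𝓘(ℝ, EP) χ (π x)).comp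
        ((mD I 𝓘(ℝ, EP) π x).comp (mD 𝓘(ℝ, E) I φ.symm (φ x))) := by
    intro x hx hxU
    have h1 : MDifferentiableAt 𝓘(ℝ, E) 𝓘(ℝ, EP) (fun v => π (φ.symm v)) (φ x) :=
      (hπ.mdifferentiableAt (by simp)).comp (φ x)
        (hφ.mdifferentiableAt_symm (φ.map_source hx))
    rw [← mD_eq_fderiv, mD_comp 𝓘(ℝ, E) 𝓘(ℝ, EP) 𝓘(ℝ, EP) (g := χ)
      (f := fun v => π (φ.symm v)) (x := φ x) ?_ h1,
      mD_comp 𝓘(ℝ, E) I 𝓘(ℝ, EP) (g := π) (f := φ.symm) (x := φ x)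
        (hπ.mdifferentiableAt (by simp)) (hφ.mdifferentiableAt_symm (φ.map_source hx)),
      φ.left_inv hx]
    rw [φ.left_inv hx]
    exact hχ.mdifferentiableAt hxU.2
  have hx₀U' : x₀ ∈ U' := ⟨hx₀, hxχ⟩
  set Φ := mD I 𝓘(ℝ, E) φ x₀ with hΦ
  -- This is `R` conjugated by the differentials of the charts, so that on the kernel of the
  -- differential of `h` its defect takes values in the image of `D` under `Φ`.
  set R' : EP →L[ℝ] E := Φ.comp (R.comp (mD 𝓘(ℝ, EP) 𝓘(ℝ, EP) χ.symm (χ (π x₀)))) with hR'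
  obtain ⟨N, hN, hNd⟩ := exists_nhds_isNowhereDense_of_leftQuasiInverse hOo hhO huO hx₀O
    (by rw [φ.left_inv hx₀φ, h0]) (by
      rw [hhd x₀ hx₀φ hx₀U']
      exact hs.comp ⟨_, hφ.mD_symm_mD hx₀φ⟩) R' (by
      refine Submodule.finiteDimensional_of_le (S₂ := D.map Φ.toLinearMap) ?_
      rintro _ ⟨⟨k, hk⟩, rfl⟩
      have hk' : fderiv ℝ (fun v => h (φ.symm v)) (φ x₀) k = 0 := hk
      rw [hhd x₀ hx₀φ hx₀U'] at hk'
      refine ⟨_, hR (mD 𝓘(ℝ, E) I φ.symm (φ x₀) k) hk', ?_⟩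
      change Φ (mD 𝓘(ℝ, E) I φ.symm (φ x₀) k - R (mD I 𝓘(ℝ, EP) π x₀
        (mD 𝓘(ℝ, E) I φ.symm (φ x₀) k))) = k - R' (fderiv ℝ (fun v => χ (π (φ.symm v))) (φ x₀) k)
      rw [hud x₀ hx₀φ hx₀U', map_sub, hΦ, hφ.mD_mD_symm hx₀φ]
      simp only [hR', ContinuousLinearMap.comp_apply, hχ.mD_symm_mD hxχ, hΦ])
  refine ⟨φ.source ∩ φ ⁻¹' (N ∩ O), Filter.inter_mem (φ.open_source.mem_nhds hx₀φ)
    ((φ.continuousAt hx₀φ).preimage_mem_nhds (Filter.inter_mem hN (hOo.mem_nhds hx₀O))), ?_⟩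
  have hUmem : ∀ x ∈ φ.source, φ x ∈ O → x ∈ U' := by
    intro x hx hxO
    have := hxO.2
    rwa [Set.mem_preimage, φ.left_inv hx] at this
  refine χ.isNowhereDense_of_image ?_ (hNd.mono ?_)
  · rintro _ ⟨x, ⟨⟨hx1, hx2, hx3⟩, -⟩, rfl⟩
    exact (hUmem x hx1 hx3).2
  · rintro _ ⟨_, ⟨x, ⟨⟨hx1, hx2, hx3⟩, hx4, hx5⟩, rfl⟩, rfl⟩
    have hxU := hUmem x hx1 hx3
    refine ⟨φ x, ⟨hx2, by rw [φ.left_inv hx1, hx4], fun hsurj => hx5 fun y => ?_⟩,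
      by simp only [φ.left_inv hx1]⟩
    obtain ⟨v, hv1, hv2⟩ := hsurj (mD 𝓘(ℝ, EP) 𝓘(ℝ, EP) χ (π x) y)
    rw [hhd x hx1 hxU] at hv1
    rw [hud x hx1 hxU] at hv2
    refine ⟨_, hv1, ?_⟩
    have h1 := congrArg (mD 𝓘(ℝ, EP) 𝓘(ℝ, EP) χ.symm (χ (π x))) hv2
    simp only [ContinuousLinearMap.comp_apply, hχ.mD_symm_mD hxU.2] at h1
    exact h1

end Defining

/-! ### Linear algebra of Fredholm operators and partial differentials. -/

section LinearAlgebra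

variable {V : Type*} [NormedAddCommGroup V] [NormedSpace ℝ V]
  {Y : Type*} [NormedAddCommGroup Y] [NormedSpace ℝ Y]

/-- Only one half of the quasi-inverse relation is kept. Stated vector by vector, it passes to every
subspace of `S`, in particular to the tangent space of the preimage of `J`, where Fredholmness may
fail. -/
theorem ContinuousLinearMap.IsFredholm.exists_leftQuasiInverse {S : Submodule ℝ V} {T : V →L[ℝ] Y}
    (hT : (T.comp S.subtypeL).IsFredholm) :
    ∃ (R : Y →L[ℝ] V) (D : Submodule ℝ V), FiniteDimensional ℝ D ∧ ∀ v ∈ S, v - R (T v) ∈ D := by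
  obtain ⟨r, hr, -⟩ := hT.exists_isQuasiInverse
  have h1 := LinearMap.FiniteRangeSetoid.equiv_iff_hasFiniteRange.1 hr.equiv
  set G := r.toLinearMap ∘ₗ (T.comp S.subtypeL).toLinearMap - LinearMap.id with hG
  have h2 : FiniteDimensional ℝ G.range := Module.Finite.of_fg h1
  refine ⟨S.subtypeL.comp r, G.range.map S.subtype, inferInstance, fun v hv => ?_⟩
  refine ⟨-G ⟨v, hv⟩, neg_mem ⟨_, rfl⟩, ?_⟩
  simp [hG]

theorem Submodule.ClosedComplemented.ker_of_hasRightInverse {A : V →L[ℝ] Y}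
    (hA : A.HasRightInverse) : A.ker.ClosedComplemented := by
  obtain ⟨s, hs⟩ := hA
  exact A.closedComplemented_ker_of_rightInverse s hs

variable {V₁ V₂ : Type*} [NormedAddCommGroup V₁] [NormedSpace ℝ V₁] [CompleteSpace V₁]
  [NormedAddCommGroup V₂] [NormedSpace ℝ V₂]

/-- If `A` is onto, and `Prod.snd` restricted to its kernel is onto with finite-dimensional
kernel, then the first partial of `A` is a split surjection. -/
theorem hasRightInverse_comp_inl [CompleteSpace Y] {A : V₁ × V₂ →L[ℝ] Y}
    (hA : Function.Surjective A) (hk : ∀ w : V₂, ∃ v, A v = 0 ∧ v.2 = w)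
    (D : Submodule ℝ (V₁ × V₂)) [FiniteDimensional ℝ D] (hD : ∀ u : V₁, A (u, 0) = 0 → (u, 0) ∈ D) :
    (A.comp (ContinuousLinearMap.inl ℝ V₁ V₂)).HasRightInverse := by
  apply ContinuousLinearMap.hasRightInverse_of_closedComplemented_ker
  · intro y
    obtain ⟨e, rfl⟩ := hA y
    obtain ⟨v, hv1, hv2⟩ := hk e.2
    -- Subtracting a kernel vector with the same second component moves `e` into the first factor
    -- without changing its value under `A`.
    refine ⟨e.1 - v.1, ?_⟩
    have h1 : ((e.1 - v.1, 0) : V₁ × V₂) = e - v := by ext <;> simp [hv2]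
    rw [ContinuousLinearMap.comp_apply, ContinuousLinearMap.inl_apply, h1, map_sub, hv1, sub_zero]
  · have : FiniteDimensional ℝ (A.comp (ContinuousLinearMap.inl ℝ V₁ V₂)).ker := by
      refine FiniteDimensional.of_injective (LinearMap.codRestrict D
        ((LinearMap.inl ℝ V₁ V₂).comp
          (A.comp (ContinuousLinearMap.inl ℝ V₁ V₂)).ker.subtype) fun u => hD _ u.2) ?_
      intro u u' h
      have h1 : ((u : V₁), (0 : V₂)) = ((u' : V₁), (0 : V₂)) := congrArg Subtype.val h
      exact Subtype.ext (congrArg Prod.fst h1)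
    exact Submodule.ClosedComplemented.of_finiteDimensional _

end LinearAlgebra

/-! ### Charts and differentials on the fibers over a parameter. -/

section Fiber

variable {EC : Type*} [NormedAddCommGroup EC] [NormedSpace ℝ EC]
  {EP : Type*} [NormedAddCommGroup EP] [NormedSpace ℝ EP]
  {EF : Type*} [NormedAddCommGroup EF] [NormedSpace ℝ EF]
  {C : Type*} [TopologicalSpace C] [ChartedSpace EC C]
  {P : Type*} [TopologicalSpace P] [ChartedSpace EP P]
  {F : Type*} [TopologicalSpace F] [ChartedSpace EF F]
  {W : Type*} [NormedAddCommGroup W] [NormedSpace ℝ W]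

/-- A map on `C × P` that is submersive along `C` is linear in a chart of `C`. -/
theorem exists_isSmoothChart_fiber [CompleteSpace EC] [IsManifold 𝓘(ℝ, EC) ∞ C] {h : C × P → W}
    {U : Set (C × P)} (hU : IsOpen U)
    (hh : ContMDiffOn (𝓘(ℝ, EC).prod 𝓘(ℝ, EP)) 𝓘(ℝ, W) ∞ h U) {c : C} {p : P} (hx : (c, p) ∈ U)
    (hs : ((mD (𝓘(ℝ, EC).prod 𝓘(ℝ, EP)) 𝓘(ℝ, W) h (c, p)).comp
      (ContinuousLinearMap.inl ℝ EC EP)).HasRightInverse) :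
    ∃ (φ : OpenPartialHomeomorph C EC) (A : EC →L[ℝ] W), IsSmoothChart 𝓘(ℝ, EC) φ ∧
      c ∈ φ.source ∧ A.HasRightInverse ∧
      (∀ c' ∈ φ.source, (c', p) ∈ U ∧ h (c', p) = A (φ c')) ∧
      ∀ v, A (mD 𝓘(ℝ, EC) 𝓘(ℝ, EC) φ c v) =
        mD (𝓘(ℝ, EC).prod 𝓘(ℝ, EP)) 𝓘(ℝ, W) h (c, p) (v, 0) := by
  have hι : ContMDiff 𝓘(ℝ, EC) (𝓘(ℝ, EC).prod 𝓘(ℝ, EP)) ∞ fun c' : C => (c', p) :=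
    contMDiff_id.prodMk contMDiff_const
  have hd : mD 𝓘(ℝ, EC) 𝓘(ℝ, W) (fun c' => h (c', p)) c =
      (mD (𝓘(ℝ, EC).prod 𝓘(ℝ, EP)) 𝓘(ℝ, W) h (c, p)).comp (ContinuousLinearMap.inl ℝ EC EP) := by
    rw [mD_comp 𝓘(ℝ, EC) (𝓘(ℝ, EC).prod 𝓘(ℝ, EP)) 𝓘(ℝ, W) (g := h) (f := fun c' => (c', p))
      ((hh.contMDiffAt (hU.mem_nhds hx)).mdifferentiableAt (by simp))
      (hι.mdifferentiableAt (by simp)), mD_prodMk_left]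
  have hopen : IsOpen ((fun c' : C => (c', p)) ⁻¹' U) := hU.preimage hι.continuous
  obtain ⟨φ, A, hφ, hc, hφU, hA, hhA⟩ := exists_isSmoothChart_linear hopen
    (g := fun c' => h (c', p)) (hh.comp hι.contMDiffOn fun c' hc' => hc') hx (by rw [hd]; exact hs)
  refine ⟨φ, A, hφ, hc, hA, fun c' hc' => ⟨hφU hc', hhA c' hc'⟩, fun v => ?_⟩
  have h1 : mD 𝓘(ℝ, EC) 𝓘(ℝ, W) (fun c' => h (c', p)) c =
      mD 𝓘(ℝ, EC) 𝓘(ℝ, W) (fun c' => A (φ c')) c := mD_congr _ _ (by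
    filter_upwards [φ.open_source.mem_nhds hc] with c' hc' using hhA c' hc')
  rw [hd, mD_comp 𝓘(ℝ, EC) 𝓘(ℝ, EC) 𝓘(ℝ, W) A.differentiableAt.mdifferentiableAt
    (hφ.mdifferentiableAt hc), mD_eq_fderiv, A.fderiv] at h1
  exact (congrArg (fun f : EC →L[ℝ] W => f v) h1).symm

/-- The differentials of a map along a submanifold and along its fibers agree. -/
theorem mDW_fiberAt {M : Set (C × P)} (hM : IsSubmanifold (𝓘(ℝ, EC).prod 𝓘(ℝ, EP)) M)
    {f : C × P → F} (hf : ContMDiffOn (𝓘(ℝ, EC).prod 𝓘(ℝ, EP)) 𝓘(ℝ, EF) ∞ f M) {c : C} {p : P}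
    (hx : (c, p) ∈ M) {u : EC} (hu : u ∈ tS 𝓘(ℝ, EC) (fiberAt M p) c)
    (huM : (u, 0) ∈ tS (𝓘(ℝ, EC).prod 𝓘(ℝ, EP)) M (c, p)) :
    mDW 𝓘(ℝ, EC) 𝓘(ℝ, EF) (fun c' => f (c', p)) (fiberAt M p) c u =
      mDW (𝓘(ℝ, EC).prod 𝓘(ℝ, EP)) 𝓘(ℝ, EF) f M (c, p) (u, 0) := by
  obtain ⟨φ, L, hφ, hxφ, hL, hS⟩ := hM _ hx
  obtain ⟨U, g, hU, hxU, hg, hgf⟩ := exists_local_extension hφ hL hS hxφ hx hf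
  have hι : ContMDiff 𝓘(ℝ, EC) (𝓘(ℝ, EC).prod 𝓘(ℝ, EP)) ∞ fun c' : C => (c', p) :=
    contMDiff_id.prodMk contMDiff_const
  have hgd := (hg.contMDiffAt (hU.mem_nhds hxU)).mdifferentiableAt (by simp)
  have hfp : ContMDiffOn 𝓘(ℝ, EC) 𝓘(ℝ, EF) ∞ (fun c' => f (c', p)) (fiberAt M p) :=
    hf.comp hι.contMDiffOn fun c' hc' => hc'
  rw [mDW_eq_mD_of_mem_tS _ _ ((hf _ hx).mdifferentiableWithinAt (by simp)) hgd
    (by filter_upwards [hU.mem_nhds hxU] with y hy using hgf y hy) huM,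
    mDW_eq_mD_of_mem_tS _ _ (g := fun c' => g (c', p))
      ((hfp c hx).mdifferentiableWithinAt (by simp))
      (hgd.comp c (hι.mdifferentiableAt (by simp)))
      (by
        filter_upwards [(hU.preimage hι.continuous).mem_nhds hxU] with c' hc' hc'M
        exact hgf _ hc' hc'M) hu,
    mD_comp 𝓘(ℝ, EC) (𝓘(ℝ, EC).prod 𝓘(ℝ, EP)) 𝓘(ℝ, EF) (g := g)
      (f := fun c' => (c', p)) hgd (hι.mdifferentiableAt (by simp)),
    mD_prodMk_left]
  rfl

end Fiber

/-! ### Pulling back defining maps. -/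

section Pullback

variable {E : Type*} [NormedAddCommGroup E] [NormedSpace ℝ E]
  {H : Type*} [TopologicalSpace H] {I : ModelWithCorners ℝ E H}
  {X : Type*} [TopologicalSpace X] [ChartedSpace H X]
  {EF : Type*} [NormedAddCommGroup EF] [NormedSpace ℝ EF]
  {F : Type*} [TopologicalSpace F] [ChartedSpace EF F]
  {W : Type*} [NormedAddCommGroup W] [NormedSpace ℝ W]

/-- The pullback of a defining map of `J` along `f`. -/
theorem exists_pullback_isDefiningOn {M : Set X} (hM : IsSubmanifold I M) {f : X → F}
    (hf : ContMDiffOn I 𝓘(ℝ, EF) ∞ f M) {J : Set F} {g : F → W} {V : Set F}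
    (hg : IsDefiningOn 𝓘(ℝ, EF) J g V) {x : X} (hx : x ∈ M) (hfx : f x ∈ V) :
    ∃ (k : X → W) (U : Set X), IsOpen U ∧ x ∈ U ∧ ContMDiffOn I 𝓘(ℝ, W) ∞ k U ∧
      ∀ y ∈ U, y ∈ M → f y ∈ V ∧ k y = g (f y) ∧
        ∀ v ∈ tS I M y, mD I 𝓘(ℝ, W) k y v =
          mD 𝓘(ℝ, EF) 𝓘(ℝ, W) g (f y) (mDW I 𝓘(ℝ, EF) f M y v) := by
  obtain ⟨φ, L, hφ, hxφ, hL, hS⟩ := hM _ hx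
  obtain ⟨U, e, hU, hxU, he, hef⟩ := exists_local_extension hφ hL hS hxφ hx hf
  have hopen : IsOpen (U ∩ e ⁻¹' V) := he.continuousOn.isOpen_inter_preimage hU hg.isOpen
  refine ⟨fun y => g (e y), U ∩ e ⁻¹' V, hopen, ⟨hxU, ?_⟩,
    hg.contMDiffOn.comp (he.mono Set.inter_subset_left) fun y hy => hy.2, fun y hy hyM => ?_⟩
  · rw [Set.mem_preimage, hef x hxU hx]; exact hfx
  · have hey := hef y hy.1 hyM
    have hfV : f y ∈ V := hey ▸ hy.2
    have hed := (he.contMDiffAt (hU.mem_nhds hy.1)).mdifferentiableAt (by simp)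
    refine ⟨hfV, congrArg g hey, fun v hv => ?_⟩
    rw [mDW_eq_mD_of_mem_tS _ _ ((hf _ hyM).mdifferentiableWithinAt (by simp)) hed
      (by filter_upwards [hU.mem_nhds hy.1] with z hz using hef z hz) hv,
      mD_comp I 𝓘(ℝ, EF) 𝓘(ℝ, W) (hg.mdifferentiableAt hy.2) hed, hey]
    rfl

end Pullback

/-! ### Meagreness of the critical values of the projections to the parameter space. -/

section Parametric

variable {EC : Type*} [NormedAddCommGroup EC] [NormedSpace ℝ EC]
  {EP : Type*} [NormedAddCommGroup EP] [NormedSpace ℝ EP]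
  {EF : Type*} [NormedAddCommGroup EF] [NormedSpace ℝ EF]
  {C : Type*} [TopologicalSpace C] [ChartedSpace EC C]
  {P : Type*} [TopologicalSpace P] [ChartedSpace EP P]
  {F : Type*} [TopologicalSpace F] [ChartedSpace EF F]

/-- Only `M` has a countable base, not the ambient space, so the Lindelöf argument is run inside the
subtype. -/
theorem isMeagre_image_of_subset_secondCountable {X Y : Type*} [TopologicalSpace X]
    [TopologicalSpace Y] {M s : Set X} [SecondCountableTopology M] (hs : s ⊆ M) {g : X → Y}
    (h : ∀ x ∈ s, ∃ N ∈ 𝓝 x, IsNowhereDense (g '' (N ∩ s))) : IsMeagre (g '' s) := by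
  have h1 : IsMeagre ((fun x : M => g x) '' (Subtype.val ⁻¹' s)) := by
    refine isMeagre_image_of_forall_exists_nhds fun x hx => ?_
    obtain ⟨N, hN, hN'⟩ := h x hx
    refine ⟨Subtype.val ⁻¹' N, continuous_subtype_val.continuousAt.preimage_mem_nhds hN,
      (hN'.mono ?_).isMeagre⟩
    rintro _ ⟨y, hy, rfl⟩
    exact ⟨y, hy, rfl⟩
  refine h1.mono ?_
  rintro _ ⟨x, hx, rfl⟩
  exact ⟨⟨x, hs hx⟩, hx, rfl⟩

theorem mem_tS_snd_eq {M : Set (C × P)} {x : C × P} {v : EC × EP}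
    (hv : v ∈ tS (𝓘(ℝ, EC).prod 𝓘(ℝ, EP)) M x) :
    mDW (𝓘(ℝ, EC).prod 𝓘(ℝ, EP)) 𝓘(ℝ, EP) Prod.snd M x v = v.2 := by
  rw [mDW_eq_mD_of_mem_tS _ _ mdifferentiableWithinAt_snd mdifferentiableAt_snd
    (Filter.Eventually.of_forall fun y _ => rfl) hv, mD_snd]
  rfl

theorem BanachSubmanifold.IsFredholmOn.exists_leftQuasiInverse {M : Set (C × P)}
    (hπ : IsFredholmOn (𝓘(ℝ, EC).prod 𝓘(ℝ, EP)) 𝓘(ℝ, EP) Prod.snd M) {x : C × P} (hx : x ∈ M) :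
    ∃ (R : EP →L[ℝ] EC × EP) (D : Submodule ℝ (EC × EP)), FiniteDimensional ℝ D ∧
      ∀ v ∈ tS (𝓘(ℝ, EC).prod 𝓘(ℝ, EP)) M x, v - R v.2 ∈ D := by
  have h : ((mDW (𝓘(ℝ, EC).prod 𝓘(ℝ, EP)) 𝓘(ℝ, EP) Prod.snd M x).comp
      (tS (𝓘(ℝ, EC).prod 𝓘(ℝ, EP)) M x).subtypeL).IsFredholm := hπ x hx
  obtain ⟨R, D, hD, hRD⟩ := h.exists_leftQuasiInverse
  refine ⟨R, D, hD, fun v hv => ?_⟩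
  have := hRD v hv
  rwa [mem_tS_snd_eq hv] at this

variable {E : Type*} [NormedAddCommGroup E] [NormedSpace ℝ E]
  {H : Type*} [TopologicalSpace H] {I : ModelWithCorners ℝ E H}
  {X : Type*} [TopologicalSpace X] [ChartedSpace H X]

/-- Transversality as solvability of `df v ≡ w` modulo `T J`, the form used in all later
computations. -/
theorem BanachSubmanifold.IsTransverseOn.exists_sub_mem {M : Set X} {f : X → F} {J : Set F}
    (h : IsTransverseOn I 𝓘(ℝ, EF) f M J) {x : X} (hx : x ∈ M) (hfx : f x ∈ J) (w : EF) :
    ∃ v ∈ tS I M x, mDW I 𝓘(ℝ, EF) f M x v - w ∈ tS 𝓘(ℝ, EF) J (f x) := by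
  have h1 : ((mDW I 𝓘(ℝ, EF) f M x).comp (tS I M x).subtypeL).range ⊔ tS 𝓘(ℝ, EF) J (f x) = ⊤ :=
    (h x hx hfx).1
  obtain ⟨_, ⟨v, rfl⟩, b, hb, hab⟩ := Submodule.mem_sup.1 (h1 ▸ Submodule.mem_top : w ∈ _)
  refine ⟨v, v.2, ?_⟩
  have h2 : mDW I 𝓘(ℝ, EF) f M x v + b = w := hab
  rw [← h2, sub_add_cancel_left]
  exact neg_mem hb

variable {W₁ W₂ : Type*} [NormedAddCommGroup W₁] [NormedSpace ℝ W₁]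
  [NormedAddCommGroup W₂] [NormedSpace ℝ W₂]

theorem mD_prodMk_apply {g : X → W₁} {k : X → W₂} {x : X}
    (hg : MDifferentiableAt I 𝓘(ℝ, W₁) g x) (hk : MDifferentiableAt I 𝓘(ℝ, W₂) k x) :
    mD I 𝓘(ℝ, W₁ × W₂) (fun y => (g y, k y)) x =
      (mD I 𝓘(ℝ, W₁) g x).prod (mD I 𝓘(ℝ, W₂) k x) := by
  have hp := hg.prodMk_space hk
  have h1 := mD_comp I 𝓘(ℝ, W₁ × W₂) 𝓘(ℝ, W₁) (g := Prod.fst)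
    (ContinuousLinearMap.fst ℝ W₁ W₂).differentiableAt.mdifferentiableAt hp
  have h2 := mD_comp I 𝓘(ℝ, W₁ × W₂) 𝓘(ℝ, W₂) (g := Prod.snd)
    (ContinuousLinearMap.snd ℝ W₁ W₂).differentiableAt.mdifferentiableAt hp
  rw [mD_eq_fderiv, fderiv_fst] at h1
  rw [mD_eq_fderiv, fderiv_snd] at h2
  refine ContinuousLinearMap.ext fun v => Prod.ext ?_ ?_
  · exact (congrArg (fun f : E →L[ℝ] W₁ => f v) h1).symm
  · exact (congrArg (fun f : E →L[ℝ] W₂ => f v) h2).symm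

/-- The pair of a defining map of `M` and a pulled back defining map of `J` is a submersion. -/
theorem BanachSubmanifold.IsTransverseOn.hasRightInverse_prod [CompleteSpace E] [CompleteSpace W₂]
    {M : Set X} {f : X → F} {J : Set F} (h : IsTransverseOn I 𝓘(ℝ, EF) f M J) {g : X → W₁}
    {U : Set X} (hg : IsDefiningOn I M g U) {k : X → W₂} {gJ : F → W₂} {V : Set F}
    (hgJ : IsDefiningOn 𝓘(ℝ, EF) J gJ V) {x : X} (hx : x ∈ M) (hxU : x ∈ U) (hfx : f x ∈ J)
    (hfV : f x ∈ V)
    (hk : ∀ v ∈ tS I M x, mD I 𝓘(ℝ, W₂) k x v =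
      mD 𝓘(ℝ, EF) 𝓘(ℝ, W₂) gJ (f x) (mDW I 𝓘(ℝ, EF) f M x v)) :
    ((mD I 𝓘(ℝ, W₁) g x).prod (mD I 𝓘(ℝ, W₂) k x)).HasRightInverse := by
  refine (hg.hasRightInverse x hxU).prod ?_
  have hker : (mD I 𝓘(ℝ, W₁) g x).ker = tS I M x := by
    ext v
    exact (hg.mem_tS_iff x hxU hx v).symm
  have hcs : CompleteSpace (mD I 𝓘(ℝ, W₁) g x).ker :=
    (mD I 𝓘(ℝ, W₁) g x).isClosed_ker.completeSpace_coe
  rw [hker] at hcs ⊢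
  apply ContinuousLinearMap.hasRightInverse_of_closedComplemented_ker
  · intro w
    obtain ⟨u, rfl⟩ := (hgJ.hasRightInverse _ hfV).surjective w
    obtain ⟨v, hv, hvu⟩ := h.exists_sub_mem hx hfx u
    refine ⟨⟨v, hv⟩, ?_⟩
    rw [hgJ.mem_tS_iff _ hfV hfx, map_sub, sub_eq_zero] at hvu
    exact (hk v hv).trans hvu
  · have h1 : ((tS 𝓘(ℝ, EF) J (f x)).comap
        ((mDW I 𝓘(ℝ, EF) f M x).comp (tS I M x).subtypeL).toLinearMap).ClosedComplemented :=
      (h x hx hfx).2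
    have heq : ((mD I 𝓘(ℝ, W₂) k x).comp (tS I M x).subtypeL).ker =
        (tS 𝓘(ℝ, EF) J (f x)).comap
          ((mDW I 𝓘(ℝ, EF) f M x).comp (tS I M x).subtypeL).toLinearMap := by
      ext v
      refine Iff.trans ?_ (hgJ.mem_tS_iff _ hfV hfx _).symm
      change mD I 𝓘(ℝ, W₂) k x v = 0 ↔
        mD 𝓘(ℝ, EF) 𝓘(ℝ, W₂) gJ (f x) (mDW I 𝓘(ℝ, EF) f M x v) = 0
      rw [hk _ v.2]
    rw [heq]
    exact h1

variable (EC EP EF)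

/-- The critical points of the projection of `M` to `P`. -/
def sndCritical (M : Set (C × P)) : Set (C × P) :=
  {x ∈ M | ¬ ∀ w : EP, ∃ v ∈ tS (𝓘(ℝ, EC).prod 𝓘(ℝ, EP)) M x, v.2 = w}

/-- The critical points of the projection to `P` of the preimage of `J` in `M`. -/
def sndCriticalOver (M : Set (C × P)) (f : C × P → F) (J : Set F) : Set (C × P) :=
  {x ∈ M | f x ∈ J ∧ ¬ ∀ w : EP, ∃ v ∈ tS (𝓘(ℝ, EC).prod 𝓘(ℝ, EP)) M x,
    mDW (𝓘(ℝ, EC).prod 𝓘(ℝ, EP)) 𝓘(ℝ, EF) f M x v ∈ tS 𝓘(ℝ, EF) J (f x) ∧ v.2 = w}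

variable {EC EP EF}
variable [CompleteSpace EC] [CompleteSpace EP] [IsManifold 𝓘(ℝ, EP) ∞ P]

theorem isMeagre_snd_image_sndCritical {M : Set (C × P)} [SecondCountableTopology M]
    (hM : IsSubmanifold (𝓘(ℝ, EC).prod 𝓘(ℝ, EP)) M)
    (hπ : IsFredholmOn (𝓘(ℝ, EC).prod 𝓘(ℝ, EP)) 𝓘(ℝ, EP) Prod.snd M) :
    IsMeagre (Prod.snd '' sndCritical EC EP M) := by
  refine isMeagre_image_of_subset_secondCountable (fun x hx => hx.1) fun x hx => ?_
  obtain ⟨φ, L, hφ, hxφ, hL, hS⟩ := hM x hx.1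
  obtain ⟨W, g, hW, hg⟩ := exists_isDefiningOn_of_isSlice hφ hL hS
  obtain ⟨R, D, hD, hRD⟩ := hπ.exists_leftQuasiInverse hx.1
  obtain ⟨N, hN, hNd⟩ := exists_nhds_isNowhereDense_image hφ contMDiff_snd hg.isOpen
    hg.contMDiffOn hxφ hxφ ((hg.mem_iff x hxφ).1 hx.1) (hg.hasRightInverse x hxφ) R D
    (fun v hv => by
      rw [mD_snd]
      exact hRD v ((hg.mem_tS_iff x hxφ hx.1 v).2 hv))
  refine ⟨N ∩ φ.source, Filter.inter_mem hN (φ.open_source.mem_nhds hxφ), hNd.mono ?_⟩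
  rintro _ ⟨y, ⟨⟨hyN, hyφ⟩, hyM, hyc⟩, rfl⟩
  refine ⟨y, ⟨hyN, (hg.mem_iff y hyφ).1 hyM, fun h => hyc fun w => ?_⟩, rfl⟩
  obtain ⟨v, hv1, hv2⟩ := h w
  rw [mD_snd] at hv2
  exact ⟨v, (hg.mem_tS_iff y hyφ hyM v).2 hv1, hv2⟩

/-- Local Sard–Smale along the zero set of `(g, k)`. The kernel of its differential lies in the
tangent space of `M`, so the quasi-inverse `R` and the defect space `D` of `M` serve unchanged,
whatever the codimension of `J`. -/
theorem isMeagre_snd_image_sndCriticalOver [CompleteSpace EF] {M : Set (C × P)} [SecondCountableTopology M]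
    (hM : IsSubmanifold (𝓘(ℝ, EC).prod 𝓘(ℝ, EP)) M)
    (hπ : IsFredholmOn (𝓘(ℝ, EC).prod 𝓘(ℝ, EP)) 𝓘(ℝ, EP) Prod.snd M)
    {f : C × P → F} (hf : ContMDiffOn (𝓘(ℝ, EC).prod 𝓘(ℝ, EP)) 𝓘(ℝ, EF) ∞ f M)
    {J : Set F} (hJ : IsSubmanifold 𝓘(ℝ, EF) J)
    (hfJ : IsTransverseOn (𝓘(ℝ, EC).prod 𝓘(ℝ, EP)) 𝓘(ℝ, EF) f M J) :
    IsMeagre (Prod.snd '' sndCriticalOver EC EP EF M f J) := by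
  refine isMeagre_image_of_subset_secondCountable (fun x hx => hx.1) fun x hx => ?_
  obtain ⟨φ, L, hφ, hxφ, hL, hS⟩ := hM x hx.1
  obtain ⟨W, g, hW, hg⟩ := exists_isDefiningOn_of_isSlice hφ hL hS
  obtain ⟨ψ, LJ, hψ, hxψ, hLJ, hSJ⟩ := hJ _ hx.2.1
  obtain ⟨W', gJ, hW', hgJ⟩ := exists_isDefiningOn_of_isSlice hψ hLJ hSJ
  obtain ⟨k, U, hU, hxU, hks, hk⟩ := exists_pullback_isDefiningOn hM hf hgJ hx.1 hxψ
  obtain ⟨R, D, hD, hRD⟩ := hπ.exists_leftQuasiInverse hx.1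
  have hd : ∀ y ∈ φ.source ∩ U,
      mD (𝓘(ℝ, EC).prod 𝓘(ℝ, EP)) 𝓘(ℝ, W × W') (fun y => (g y, k y)) y =
      (mD (𝓘(ℝ, EC).prod 𝓘(ℝ, EP)) 𝓘(ℝ, W) g y).prod
        (mD (𝓘(ℝ, EC).prod 𝓘(ℝ, EP)) 𝓘(ℝ, W') k y) := fun y hy =>
    mD_prodMk_apply (hg.mdifferentiableAt hy.1)
      ((hks.contMDiffAt (hU.mem_nhds hy.2)).mdifferentiableAt (by simp))
  have hzero : ∀ y ∈ φ.source ∩ U, y ∈ M → f y ∈ J → (g y, k y) = 0 := by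
    intro y hy hyM hyJ
    obtain ⟨h1, h2, -⟩ := hk y hy.2 hyM
    rw [(hg.mem_iff y hy.1).1 hyM, h2, (hgJ.mem_iff _ h1).1 hyJ]
    rfl
  have hxφU : x ∈ φ.source ∩ U := ⟨hxφ, hxU⟩
  obtain ⟨N, hN, hNd⟩ := exists_nhds_isNowhereDense_image (h := fun y => (g y, k y)) hφ
    contMDiff_snd (φ.open_source.inter hU)
    ((hg.contMDiffOn.mono Set.inter_subset_left).prodMk_space (hks.mono Set.inter_subset_right))
    hxφU hxφ (hzero x hxφU hx.1 hx.2.1) (by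
      rw [hd x hxφU]
      exact hfJ.hasRightInverse_prod hg hgJ hx.1 hxφ hx.2.1 hxψ (hk x hxU hx.1).2.2) R D
    (fun v hv => by
      rw [hd x hxφU] at hv
      rw [mD_snd]
      exact hRD v ((hg.mem_tS_iff x hxφ hx.1 v).2 (congrArg Prod.fst hv)))
  refine ⟨N ∩ (φ.source ∩ U), Filter.inter_mem hN
    ((φ.open_source.inter hU).mem_nhds hxφU), hNd.mono ?_⟩
  rintro _ ⟨y, ⟨⟨hyN, hyφU⟩, hyM, hyJ, hyc⟩, rfl⟩
  refine ⟨y, ⟨hyN, hzero y hyφU hyM hyJ, fun h => hyc fun w => ?_⟩, rfl⟩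
  obtain ⟨v, hv1, hv2⟩ := h w
  rw [mD_snd] at hv2
  rw [hd y hyφU] at hv1
  have hvM := (hg.mem_tS_iff y hyφU.1 hyM v).2 (congrArg Prod.fst hv1)
  obtain ⟨h1, -, h3⟩ := hk y hyφU.2 hyM
  refine ⟨v, hvM, ?_, hv2⟩
  rw [hgJ.mem_tS_iff _ h1 hyJ, ← h3 v hvM]
  exact congrArg Prod.snd hv1

end Parametric

/-! ### Geometry of the fiber over a regular parameter. -/

section RegularFiber

/-- The map `A → Y / J` induced by `δ` is onto with kernel `A ∩ B`. The two quotients may live in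
different universes, hence the lifts. -/
theorem toENat_rank_quotient_eq {V Y : Type*} [AddCommGroup V] [Module ℝ V] [AddCommGroup Y]
    [Module ℝ Y] {A B : Submodule ℝ V} {J : Submodule ℝ Y} (δ : V →ₗ[ℝ] Y)
    (hδ : ∀ w, ∃ u ∈ A, δ u - w ∈ J) (hB : ∀ u ∈ A, u ∈ B ↔ δ u ∈ J) :
    Cardinal.toENat (Module.rank ℝ (A ⧸ B.submoduleOf A)) =
      Cardinal.toENat (Module.rank ℝ (Y ⧸ J)) := by
  set Λ : A →ₗ[ℝ] Y ⧸ J := J.mkQ ∘ₗ δ ∘ₗ A.subtype with hΛ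
  have hker : Λ.ker = B.submoduleOf A := by
    ext u
    exact (Submodule.Quotient.mk_eq_zero J).trans (hB _ u.2).symm
  have hsurj : Function.Surjective Λ := by
    intro w
    obtain ⟨w, rfl⟩ := J.mkQ_surjective w
    obtain ⟨u, hu, huw⟩ := hδ w
    exact ⟨⟨u, hu⟩, (Submodule.Quotient.eq J).2 huw⟩
  rw [← hker, ← Cardinal.toENat_lift, (Λ.quotKerEquivOfSurjective hsurj).lift_rank_eq,
    Cardinal.toENat_lift]

variable {EC : Type*} [NormedAddCommGroup EC] [NormedSpace ℝ EC]
  {EP : Type*} [NormedAddCommGroup EP] [NormedSpace ℝ EP]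
  {EF : Type*} [NormedAddCommGroup EF] [NormedSpace ℝ EF]
  {C : Type*} [TopologicalSpace C] [ChartedSpace EC C]
  {P : Type*} [TopologicalSpace P] [ChartedSpace EP P]
  {F : Type*} [TopologicalSpace F] [ChartedSpace EF F]

/-- Regularity makes the partial differential of `g` along `C` onto, and the Fredholm property makes
its kernel finite-dimensional, hence complemented. So `g(·, p)` is a submersion at `c` and becomes
linear in a chart of `C`. -/
theorem exists_isSlice_fiberAt [CompleteSpace EC] [CompleteSpace EP] [IsManifold 𝓘(ℝ, EC) ∞ C]
    {M : Set (C × P)} (hM : IsSubmanifold (𝓘(ℝ, EC).prod 𝓘(ℝ, EP)) M)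
    (hπ : IsFredholmOn (𝓘(ℝ, EC).prod 𝓘(ℝ, EP)) 𝓘(ℝ, EP) Prod.snd M) {c : C} {p : P}
    (hx : (c, p) ∈ M)
    (hreg : ∀ w : EP, ∃ v ∈ tS (𝓘(ℝ, EC).prod 𝓘(ℝ, EP)) M (c, p), v.2 = w) :
    (∃ (φ : OpenPartialHomeomorph C EC) (L : Submodule ℝ EC), IsSmoothChart 𝓘(ℝ, EC) φ ∧
      c ∈ φ.source ∧ L.ClosedComplemented ∧ IsSlice φ (fiberAt M p) L) ∧
    ∀ u, u ∈ tS 𝓘(ℝ, EC) (fiberAt M p) c ↔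
      (u, 0) ∈ tS (𝓘(ℝ, EC).prod 𝓘(ℝ, EP)) M (c, p) := by
  obtain ⟨φ, L, hφ, hxφ, hL, hS⟩ := hM _ hx
  obtain ⟨W, g, hW, hg⟩ := exists_isDefiningOn_of_isSlice hφ hL hS
  obtain ⟨R, D, hD, hRD⟩ := hπ.exists_leftQuasiInverse hx
  obtain ⟨ψ, A, hψ, hc, hA, hψA, hd⟩ := exists_isSmoothChart_fiber hg.isOpen hg.contMDiffOn hxφ
    (hasRightInverse_comp_inl (hg.hasRightInverse _ hxφ).surjective (fun w => by
      obtain ⟨v, hv, hvw⟩ := hreg w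
      exact ⟨v, (hg.mem_tS_iff _ hxφ hx v).1 hv, hvw⟩) D (fun u hu => by
      have := hRD _ ((hg.mem_tS_iff _ hxφ hx _).2 hu)
      simpa using this))
  have hslice : IsSlice ψ (fiberAt M p) A.ker := fun c' hc' => by
    obtain ⟨h1, h2⟩ := hψA c' hc'
    exact (hg.mem_iff _ h1).trans (by rw [h2]; rfl)
  have hcc := Submodule.ClosedComplemented.ker_of_hasRightInverse hA
  refine ⟨⟨ψ, A.ker, hψ, hc, hcc, hslice⟩, fun u => ?_⟩
  rw [mem_tS_iff_of_isSlice hψ hcc hslice hc hx, hg.mem_tS_iff _ hxφ hx, ← hd]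
  rfl

theorem finiteDimensional_tS_fiberAt {M : Set (C × P)}
    (hπ : IsFredholmOn (𝓘(ℝ, EC).prod 𝓘(ℝ, EP)) 𝓘(ℝ, EP) Prod.snd M) {c : C} {p : P}
    (hx : (c, p) ∈ M)
    (hfib : ∀ u, u ∈ tS 𝓘(ℝ, EC) (fiberAt M p) c ↔
      (u, 0) ∈ tS (𝓘(ℝ, EC).prod 𝓘(ℝ, EP)) M (c, p)) :
    FiniteDimensional ℝ (tS 𝓘(ℝ, EC) (fiberAt M p) c) := by
  obtain ⟨R, D, hD, hRD⟩ := hπ.exists_leftQuasiInverse hx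
  refine FiniteDimensional.of_injective (LinearMap.codRestrict D
    ((LinearMap.inl ℝ EC EP).comp (tS 𝓘(ℝ, EC) (fiberAt M p) c).subtype) fun u => ?_) ?_
  · have := hRD _ ((hfib _).1 u.2)
    simpa using this
  · intro u u' h
    have h1 : ((u : EC), (0 : EP)) = ((u' : EC), (0 : EP)) := congrArg Subtype.val h
    exact Subtype.ext (congrArg Prod.fst h1)

/-- At a regular point the cokernel is zero, and the kernel consists of the tangent vectors `(u, 0)`
of `M`. -/
theorem finrank_tS_fiberAt {M : Set (C × P)} {c : C} {p : P}
    (hreg : ∀ w : EP, ∃ v ∈ tS (𝓘(ℝ, EC).prod 𝓘(ℝ, EP)) M (c, p), v.2 = w)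
    (hfib : ∀ u, u ∈ tS 𝓘(ℝ, EC) (fiberAt M p) c ↔
      (u, 0) ∈ tS (𝓘(ℝ, EC).prod 𝓘(ℝ, EP)) M (c, p)) :
    (Module.finrank ℝ (tS 𝓘(ℝ, EC) (fiberAt M p) c) : ℤ) =
      indexAt (𝓘(ℝ, EC).prod 𝓘(ℝ, EP)) 𝓘(ℝ, EP) Prod.snd M (c, p) := by
  set T : tS (𝓘(ℝ, EC).prod 𝓘(ℝ, EP)) M (c, p) →L[ℝ] EP :=
    (mDW (𝓘(ℝ, EC).prod 𝓘(ℝ, EP)) 𝓘(ℝ, EP) Prod.snd M (c, p)).comp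
      (tS (𝓘(ℝ, EC).prod 𝓘(ℝ, EP)) M (c, p)).subtypeL with hT
  have hTv : ∀ v, T v = v.1.2 := fun v => mem_tS_snd_eq v.2
  have hr : T.range = ⊤ := by
    rw [LinearMap.range_eq_top]
    intro w
    obtain ⟨v, hv, rfl⟩ := hreg w
    exact ⟨⟨v, hv⟩, hTv _⟩
  have h0 : Module.finrank ℝ (EP ⧸ T.range) = 0 := by
    rw [hr]
    exact Module.finrank_zero_of_subsingleton
  have hk : Module.finrank ℝ (tS 𝓘(ℝ, EC) (fiberAt M p) c) = Module.finrank ℝ T.ker := by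
    refine (LinearEquiv.ofBijective (LinearMap.codRestrict T.ker (LinearMap.codRestrict _
      ((LinearMap.inl ℝ EC EP).comp (tS 𝓘(ℝ, EC) (fiberAt M p) c).subtype)
      fun u => (hfib _).1 u.2) fun u => hTv _) ⟨fun u u' h => ?_, fun v => ?_⟩).finrank_eq
    · have h1 : ((u : EC), (0 : EP)) = ((u' : EC), (0 : EP)) :=
        congrArg (fun v => v.1.1) h
      exact Subtype.ext (congrArg Prod.fst h1)
    · obtain ⟨⟨⟨u, w⟩, hv⟩, hvk⟩ := v
      obtain rfl : w = 0 := (hTv _).symm.trans hvk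
      exact ⟨⟨u, (hfib u).2 hv⟩, rfl⟩
  have h : (Module.finrank ℝ (tS 𝓘(ℝ, EC) (fiberAt M p) c) : ℤ) =
      (Module.finrank ℝ T.ker : ℤ) - Module.finrank ℝ (EP ⧸ T.range) := by
    rw [hk, h0]
    simp
  exact h

theorem exists_mem_tS_fiberAt_sub_mem {M : Set (C × P)}
    (hM : IsSubmanifold (𝓘(ℝ, EC).prod 𝓘(ℝ, EP)) M)
    {f : C × P → F} (hf : ContMDiffOn (𝓘(ℝ, EC).prod 𝓘(ℝ, EP)) 𝓘(ℝ, EF) ∞ f M)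
    {J : Set F} (hfJ : IsTransverseOn (𝓘(ℝ, EC).prod 𝓘(ℝ, EP)) 𝓘(ℝ, EF) f M J)
    {c : C} {p : P} (hx : (c, p) ∈ M) (hxJ : f (c, p) ∈ J)
    (hreg : ∀ w : EP, ∃ v ∈ tS (𝓘(ℝ, EC).prod 𝓘(ℝ, EP)) M (c, p),
      mDW (𝓘(ℝ, EC).prod 𝓘(ℝ, EP)) 𝓘(ℝ, EF) f M (c, p) v ∈ tS 𝓘(ℝ, EF) J (f (c, p)) ∧ v.2 = w)
    (hfib : ∀ u, u ∈ tS 𝓘(ℝ, EC) (fiberAt M p) c ↔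
      (u, 0) ∈ tS (𝓘(ℝ, EC).prod 𝓘(ℝ, EP)) M (c, p)) (w : EF) :
    ∃ u ∈ tS 𝓘(ℝ, EC) (fiberAt M p) c,
      mDW 𝓘(ℝ, EC) 𝓘(ℝ, EF) (fun c' => f (c', p)) (fiberAt M p) c u - w ∈
        tS 𝓘(ℝ, EF) J (f (c, p)) := by
  obtain ⟨v, hv, hvw⟩ := hfJ.exists_sub_mem hx hxJ w
  -- A vector tangent to the preimage of `J` with the same `P`-component as `v`: subtracting it
  -- makes `v` tangent to the fiber and changes its image only by an element of `T J`.
  obtain ⟨v', hv', hvJ, hv2⟩ := hreg v.2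
  have heq : ((v.1 - v'.1, 0) : EC × EP) = v - v' := by ext <;> simp [hv2]
  have hmem : ((v.1 - v'.1, 0) : EC × EP) ∈ tS (𝓘(ℝ, EC).prod 𝓘(ℝ, EP)) M (c, p) :=
    heq ▸ sub_mem hv hv'
  refine ⟨v.1 - v'.1, (hfib _).2 hmem, ?_⟩
  rw [mDW_fiberAt hM hf hx ((hfib _).2 hmem) hmem, heq, map_sub, sub_right_comm]
  exact sub_mem hvw hvJ

theorem isTransverse_fiberAt_of_finiteDimensional {f : C → F} {N : Set C} {J : Set F} {c : C}
    [FiniteDimensional ℝ (tS 𝓘(ℝ, EC) N c)]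
    (h : ∀ w : EF, ∃ u ∈ tS 𝓘(ℝ, EC) N c,
      mDW 𝓘(ℝ, EC) 𝓘(ℝ, EF) f N c u - w ∈ tS 𝓘(ℝ, EF) J (f c)) :
    (derivAlong 𝓘(ℝ, EC) 𝓘(ℝ, EF) f N c).range ⊔ tangentSubspace 𝓘(ℝ, EF) J (f c) = ⊤ ∧
    ((tangentSubspace 𝓘(ℝ, EF) J (f c)).comap
      (derivAlong 𝓘(ℝ, EC) 𝓘(ℝ, EF) f N c).toLinearMap).ClosedComplemented := by
  set T : tS 𝓘(ℝ, EC) N c →L[ℝ] EF :=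
    (mDW 𝓘(ℝ, EC) 𝓘(ℝ, EF) f N c).comp (tS 𝓘(ℝ, EC) N c).subtypeL with hT
  have h1 : T.range ⊔ tS 𝓘(ℝ, EF) J (f c) = ⊤ := by
    rw [eq_top_iff]
    intro w _
    obtain ⟨u, hu, huw⟩ := h w
    have h2 : w = T ⟨u, hu⟩ - (mDW 𝓘(ℝ, EC) 𝓘(ℝ, EF) f N c u - w) := (sub_sub_cancel _ _).symm
    rw [h2]
    exact sub_mem (Submodule.mem_sup_left ⟨_, rfl⟩) (Submodule.mem_sup_right huw)
  have h2 : ((tS 𝓘(ℝ, EF) J (f c)).comap T.toLinearMap).ClosedComplemented :=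
    Submodule.ClosedComplemented.of_finiteDimensional _
  exact ⟨h1, h2⟩

/-- Linearizing the pair `(g, k)(·, p)` as `A` in one chart flattens both sets at once: the preimage
of `J` becomes `ker A`, and the fiber becomes the kernel of the first component of `A`. -/
theorem exists_isSlice_preimage_fiberAt [CompleteSpace EC] [CompleteSpace EP] [CompleteSpace EF]
    [IsManifold 𝓘(ℝ, EC) ∞ C] {M : Set (C × P)}
    (hM : IsSubmanifold (𝓘(ℝ, EC).prod 𝓘(ℝ, EP)) M)
    (hπ : IsFredholmOn (𝓘(ℝ, EC).prod 𝓘(ℝ, EP)) 𝓘(ℝ, EP) Prod.snd M)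
    {f : C × P → F} (hf : ContMDiffOn (𝓘(ℝ, EC).prod 𝓘(ℝ, EP)) 𝓘(ℝ, EF) ∞ f M)
    {J : Set F} (hJ : IsSubmanifold 𝓘(ℝ, EF) J)
    (hfJ : IsTransverseOn (𝓘(ℝ, EC).prod 𝓘(ℝ, EP)) 𝓘(ℝ, EF) f M J)
    {c : C} {p : P} (hx : (c, p) ∈ M) (hxJ : f (c, p) ∈ J)
    (hreg : ∀ w : EP, ∃ v ∈ tS (𝓘(ℝ, EC).prod 𝓘(ℝ, EP)) M (c, p),
      mDW (𝓘(ℝ, EC).prod 𝓘(ℝ, EP)) 𝓘(ℝ, EF) f M (c, p) v ∈ tS 𝓘(ℝ, EF) J (f (c, p)) ∧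
        v.2 = w) :
    (∃ (φ : OpenPartialHomeomorph C EC) (K L : Submodule ℝ EC), IsSmoothChart 𝓘(ℝ, EC) φ ∧
      c ∈ φ.source ∧ K ≤ L ∧ K.ClosedComplemented ∧ L.ClosedComplemented ∧
      IsSlice φ {c ∈ fiberAt M p | f (c, p) ∈ J} K ∧ IsSlice φ (fiberAt M p) L) ∧
    ∀ u, u ∈ tS 𝓘(ℝ, EC) {c ∈ fiberAt M p | f (c, p) ∈ J} c ↔
      (u, 0) ∈ tS (𝓘(ℝ, EC).prod 𝓘(ℝ, EP)) M (c, p) ∧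
      mDW (𝓘(ℝ, EC).prod 𝓘(ℝ, EP)) 𝓘(ℝ, EF) f M (c, p) (u, 0) ∈ tS 𝓘(ℝ, EF) J (f (c, p)) := by
  obtain ⟨φ, L, hφ, hxφ, hL, hS⟩ := hM _ hx
  obtain ⟨W, g, hW, hg⟩ := exists_isDefiningOn_of_isSlice hφ hL hS
  obtain ⟨ψ, LJ, hψ, hxψ, hLJ, hSJ⟩ := hJ _ hxJ
  obtain ⟨W', gJ, hW', hgJ⟩ := exists_isDefiningOn_of_isSlice hψ hLJ hSJ
  obtain ⟨k, U, hU, hxU, hks, hk⟩ := exists_pullback_isDefiningOn hM hf hgJ hx hxψ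
  obtain ⟨R, D, hD, hRD⟩ := hπ.exists_leftQuasiInverse hx
  set G := (mD (𝓘(ℝ, EC).prod 𝓘(ℝ, EP)) 𝓘(ℝ, W) g (c, p)).prod
    (mD (𝓘(ℝ, EC).prod 𝓘(ℝ, EP)) 𝓘(ℝ, W') k (c, p)) with hG
  have hd : mD (𝓘(ℝ, EC).prod 𝓘(ℝ, EP)) 𝓘(ℝ, W × W') (fun y => (g y, k y)) (c, p) = G :=
    mD_prodMk_apply (hg.mdifferentiableAt hxφ)
      ((hks.contMDiffAt (hU.mem_nhds hxU)).mdifferentiableAt (by simp))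
  have hG0 : ∀ v, G v = 0 ↔ v ∈ tS (𝓘(ℝ, EC).prod 𝓘(ℝ, EP)) M (c, p) ∧
      mDW (𝓘(ℝ, EC).prod 𝓘(ℝ, EP)) 𝓘(ℝ, EF) f M (c, p) v ∈ tS 𝓘(ℝ, EF) J (f (c, p)) := by
    intro v
    rw [hG, ContinuousLinearMap.prod_apply, Prod.mk_eq_zero, ← hg.mem_tS_iff _ hxφ hx]
    refine and_congr_right fun hv => ?_
    rw [(hk _ hxU hx).2.2 v hv, hgJ.mem_tS_iff _ hxψ hxJ]
  obtain ⟨χ, A, hχ, hc, hA, hχA, hdA⟩ := exists_isSmoothChart_fiber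
    (h := fun y => (g y, k y)) (φ.open_source.inter hU)
    ((hg.contMDiffOn.mono Set.inter_subset_left).prodMk_space (hks.mono Set.inter_subset_right))
    ⟨hxφ, hxU⟩ (by
      rw [hd]
      refine hasRightInverse_comp_inl (hfJ.hasRightInverse_prod hg hgJ hx hxφ hxJ hxψ
        (hk _ hxU hx).2.2).surjective (fun w => ?_) D fun u hu => ?_
      · obtain ⟨v, hv, hvJ, hvw⟩ := hreg w
        exact ⟨v, (hG0 v).2 ⟨hv, hvJ⟩, hvw⟩
      · have := hRD _ ((hG0 _).1 hu).1
        simpa using this)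
  rw [hd] at hdA
  have hA1 : ((ContinuousLinearMap.fst ℝ W W').comp A).HasRightInverse := by
    obtain ⟨s, hs⟩ := hA
    exact ⟨s.comp (ContinuousLinearMap.inl ℝ W W'), fun w => congrArg Prod.fst (hs (w, 0))⟩
  have hK : IsSlice χ {c ∈ fiberAt M p | f (c, p) ∈ J} A.ker := by
    intro c' hc'
    obtain ⟨⟨h1, h2⟩, h3⟩ := hχA c' hc'
    have h4 : (c', p) ∈ M ∧ f (c', p) ∈ J ↔ (g (c', p), k (c', p)) = 0 := by
      rw [Prod.mk_eq_zero, ← hg.mem_iff _ h1]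
      refine and_congr_right fun hcM => ?_
      obtain ⟨h5, h6, -⟩ := hk _ h2 hcM
      rw [h6, hgJ.mem_iff _ h5]
    exact h4.trans (by rw [h3]; rfl)
  have hKc := Submodule.ClosedComplemented.ker_of_hasRightInverse hA
  refine ⟨⟨χ, A.ker, ((ContinuousLinearMap.fst ℝ W W').comp A).ker, hχ, hc, fun v hv => ?_, hKc,
    Submodule.ClosedComplemented.ker_of_hasRightInverse hA1, hK, fun c' hc' => ?_⟩, fun u => ?_⟩
  · have h1 : A v = 0 := hv
    exact congrArg Prod.fst h1
  · obtain ⟨⟨h1, -⟩, h3⟩ := hχA c' hc'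
    have h4 : g (c', p) = (A (χ c')).1 := congrArg Prod.fst h3
    exact (hg.mem_iff _ h1).trans (by rw [h4]; rfl)
  · rw [mem_tS_iff_of_isSlice hχ hKc hK hc ⟨hx, hxJ⟩, ← hG0, ← hdA]
    rfl

end RegularFiber

/-! ### The transversality theorem for generic fibers. -/

theorem proposition4p7
    {EC : Type*} [NormedAddCommGroup EC] [NormedSpace ℝ EC] [CompleteSpace EC]
    {EP : Type*} [NormedAddCommGroup EP] [NormedSpace ℝ EP] [CompleteSpace EP]
    {EF : Type*} [NormedAddCommGroup EF] [NormedSpace ℝ EF] [CompleteSpace EF]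
    {C : Type*} [TopologicalSpace C] [ChartedSpace EC C] [IsManifold 𝓘(ℝ, EC) ∞ C]
    {P : Type*} [TopologicalSpace P] [ChartedSpace EP P] [IsManifold 𝓘(ℝ, EP) ∞ P]
    {F : Type*} [TopologicalSpace F] [ChartedSpace EF F] [IsManifold 𝓘(ℝ, EF) ∞ F]
    (M : Set (C × P)) (hM : IsSubmanifold (𝓘(ℝ, EC).prod 𝓘(ℝ, EP)) M)
    [SecondCountableTopology M]
    (hπ : IsFredholmOn (𝓘(ℝ, EC).prod 𝓘(ℝ, EP)) 𝓘(ℝ, EP) Prod.snd M)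
    (f : C × P → F) (hf : ContMDiffOn (𝓘(ℝ, EC).prod 𝓘(ℝ, EP)) 𝓘(ℝ, EF) ∞ f M)
    (J : Set F) (hJ : IsSubmanifold 𝓘(ℝ, EF) J)
    (hfJ : IsTransverseOn (𝓘(ℝ, EC).prod 𝓘(ℝ, EP)) 𝓘(ℝ, EF) f M J) :
    ∃ Pfc : Set P, IsMeagre Pfc ∧ ∀ p ∉ Pfc,
      -- the fiber over `p` is a finite-dimensional manifold, of dimension the index
      (IsSubmanifold 𝓘(ℝ, EC) (fiberAt M p) ∧
        ∀ c ∈ fiberAt M p,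
          FiniteDimensional ℝ (tangentSubspace 𝓘(ℝ, EC) (fiberAt M p) c) ∧
          (Module.finrank ℝ (tangentSubspace 𝓘(ℝ, EC) (fiberAt M p) c) : ℤ) =
            indexAt (𝓘(ℝ, EC).prod 𝓘(ℝ, EP)) 𝓘(ℝ, EP) Prod.snd M (c, p)) ∧
      -- the restriction of `f` to the fiber is smooth and transverse to `J`
      (ContMDiffOn 𝓘(ℝ, EC) 𝓘(ℝ, EF) ∞ (fun c => f (c, p)) (fiberAt M p) ∧
        IsTransverseOn 𝓘(ℝ, EC) 𝓘(ℝ, EF) (fun c => f (c, p)) (fiberAt M p) J) ∧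
      -- the preimage of `J` in the fiber is a submanifold of the codimension of `J`
      (IsSubmanifoldOf 𝓘(ℝ, EC) {c ∈ fiberAt M p | f (c, p) ∈ J} (fiberAt M p) ∧
        ∀ c ∈ fiberAt M p, f (c, p) ∈ J →
          relCodimAt 𝓘(ℝ, EC) {c ∈ fiberAt M p | f (c, p) ∈ J} (fiberAt M p) c =
            codimAt 𝓘(ℝ, EF) J (f (c, p))) := by
  refine ⟨Prod.snd '' sndCritical EC EP M ∪ Prod.snd '' sndCriticalOver EC EP EF M f J,
    (isMeagre_snd_image_sndCritical hM hπ).union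
      (isMeagre_snd_image_sndCriticalOver hM hπ hf hJ hfJ), fun p hp => ?_⟩
  have hreg : ∀ c, (c, p) ∈ M → ∀ w : EP,
      ∃ v ∈ tS (𝓘(ℝ, EC).prod 𝓘(ℝ, EP)) M (c, p), v.2 = w := fun c hc => by
    by_contra h
    exact hp (Or.inl ⟨(c, p), ⟨hc, h⟩, rfl⟩)
  have hregJ : ∀ c, (c, p) ∈ M → f (c, p) ∈ J → ∀ w : EP,
      ∃ v ∈ tS (𝓘(ℝ, EC).prod 𝓘(ℝ, EP)) M (c, p),
        mDW (𝓘(ℝ, EC).prod 𝓘(ℝ, EP)) 𝓘(ℝ, EF) f M (c, p) v ∈ tS 𝓘(ℝ, EF) J (f (c, p)) ∧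
          v.2 = w := fun c hc hcJ => by
    by_contra h
    exact hp (Or.inr ⟨(c, p), ⟨hc, hcJ, h⟩, rfl⟩)
  have hfib : ∀ c, (c, p) ∈ M → ∀ u, u ∈ tS 𝓘(ℝ, EC) (fiberAt M p) c ↔
      (u, 0) ∈ tS (𝓘(ℝ, EC).prod 𝓘(ℝ, EP)) M (c, p) := fun c hc =>
    (exists_isSlice_fiberAt hM hπ hc (hreg c hc)).2
  have hfin : ∀ c, (c, p) ∈ M → FiniteDimensional ℝ (tS 𝓘(ℝ, EC) (fiberAt M p) c) :=
    fun c hc => finiteDimensional_tS_fiberAt hπ hc (hfib c hc)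
  have hι : ContMDiff 𝓘(ℝ, EC) (𝓘(ℝ, EC).prod 𝓘(ℝ, EP)) ∞ fun c : C => (c, p) :=
    contMDiff_id.prodMk contMDiff_const
  have htr : ∀ c, (c, p) ∈ M → f (c, p) ∈ J → ∀ w : EF, ∃ u ∈ tS 𝓘(ℝ, EC) (fiberAt M p) c,
      mDW 𝓘(ℝ, EC) 𝓘(ℝ, EF) (fun c' => f (c', p)) (fiberAt M p) c u - w ∈
        tS 𝓘(ℝ, EF) J (f (c, p)) := fun c hc hcJ =>
    exists_mem_tS_fiberAt_sub_mem hM hf hfJ hc hcJ (hregJ c hc hcJ) (hfib c hc)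
  have hrank : ∀ c, (c, p) ∈ M → (Module.finrank ℝ (tS 𝓘(ℝ, EC) (fiberAt M p) c) : ℤ) =
      indexAt (𝓘(ℝ, EC).prod 𝓘(ℝ, EP)) 𝓘(ℝ, EP) Prod.snd M (c, p) := fun c hc =>
    finrank_tS_fiberAt (hreg c hc) (hfib c hc)
  refine ⟨⟨fun c hc => (exists_isSlice_fiberAt hM hπ hc (hreg c hc)).1, fun c hc =>
    ⟨hfin c hc, hrank c hc⟩⟩,
    ⟨hf.comp hι.contMDiffOn fun c hc => hc, fun c hc hcJ => ?_⟩,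
    ⟨⟨fun c hc => hc.1, fun c hc => (exists_isSlice_preimage_fiberAt hM hπ hf hJ hfJ hc.1 hc.2
      (hregJ c hc.1 hc.2)).1⟩, fun c hc hcJ => ?_⟩⟩
  · have := hfin c hc
    exact isTransverse_fiberAt_of_finiteDimensional (htr c hc hcJ)
  -- Transversality of the restricted map gives surjectivity onto `T F / T J`; the description of
  -- the tangent space of the preimage identifies the kernel.
  · have h := toENat_rank_quotient_eq (V := EC) (Y := EF) (A := tS 𝓘(ℝ, EC) (fiberAt M p) c)
      (J := tS 𝓘(ℝ, EF) J (f (c, p)))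
      (B := tS 𝓘(ℝ, EC) {c ∈ fiberAt M p | f (c, p) ∈ J} c)
      (mDW 𝓘(ℝ, EC) 𝓘(ℝ, EF) (fun c' => f (c', p)) (fiberAt M p) c).toLinearMap (htr c hc hcJ)
      (fun u hu => by
        have h1 := (hfib c hc u).1 hu
        have h2 := mDW_fiberAt hM hf hc hu h1
        rw [(exists_isSlice_preimage_fiberAt hM hπ hf hJ hfJ hc hcJ (hregJ c hc hcJ)).2,
          ContinuousLinearMap.coe_coe, h2]
        exact and_iff_right h1)
    exact h
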